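/- Let $k$ be a commutative ring containing $\mathbb{Q}$ and let $\Gamma$ be a quiver with set of vertices $\Gamma_0$. Let $k\Gamma$ be its path algebra and let $\mathfrak{m}\subseteq k\Gamma$ be the two-sided ideal generated by the paths of length $1$. For an associative $k$-algebra $A$ (not necessarily unital, since $k\Gamma$ has a unit only when $\Gamma_0$ is finite), let $HC_n(A)$ denote the cyclic homology of $A$ over $k$, that is, the $n$-th homology of the total complex of the cyclic bicomplex of $A$. Let $\mathcal{C}$ be the set of oriented cycles of $\Gamma$ (paths whose source and target coincide, including the paths of length $0$), and let $\overline{\mathcal{C}}$ be the set of orbits of cycles under cyclic rotation. Then there are isomorphisms of $k$-modules $$HC_{2c}(k\Gamma/\mathfrak{m})\cong\bigoplus_{s\in\Gamma_0}ks,\qquad HC_{2c+1}(k\Gamma/\mathfrak{m})=0\qquad\text{for all } c\ge 0,$$ and $$HC_0(k\Gamma)\cong k\overline{\mathcal{C}},\qquad HC_{2c}(k\Gamma)\cong k^{(\Gamma_0)}\ \text{ for all } c\ge 1,\qquad HC_{2c+1}(k\Gamma)=0\ \text{ for all } c\ge 0,$$ where $k\overline{\mathcal{C}}$ is the free $k$-module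 on $\overline{\mathcal{C}}$, where $k^{(\Gamma_0)}$ is the free $k$-module on $\Gamma_0$ (that is, $k^{\#\Gamma_0}$ when $\Gamma_0$ is finite), and where the isomorphism $HC_0(k\Gamma)\cong k\overline{\mathcal{C}}$ can be chosen so that it sends the class of each cycle to its orbit. -/

import Mathlib

noncomputable section

open scoped TensorProduct

universe u v w

/-! ### Cyclic homology of a (not necessarily unital) associative algebra -/

namespace CyclicHomology

variable (k : Type*) [CommRing k] (A : Type*) [NonUnitalRing A] [Module k A]
  [IsScalarTower k A A] [SMulCommClass k A A]

theorem contractNth_update {A : Type*} [Mul A] (q : ℕ) (i : Fin (q + 1)) (m : Fin (q + 2) → A)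
    (j : Fin (q + 2)) (z : A) :
    Fin.contractNth i.castSucc (· * ·) (Function.update m j z) =
      Function.update (Fin.contractNth i.castSucc (· * ·) m) (i.predAbove j)
        (if j = i.castSucc then z * m i.succ else if j = i.succ then m i.castSucc * z else z) := by
  funext l
  have hp : l = i.predAbove j ↔ (l : ℕ) = if (i : ℕ) < j then (j : ℕ) - 1 else j := by
    rw [Fin.predAbove, Fin.ext_iff]
    split_ifs with h h' h' <;> simp only [Fin.lt_def, Fin.val_castSucc] at h <;>
      first
        | omega
        | simp
  simp only [Fin.contractNth, Function.update_apply, hp, Fin.ext_iff, Fin.val_castSucc,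
    Fin.val_succ]
  have hm : ∀ (c d : Fin (q + 2)), (c : ℕ) = d → m c = m d := fun c d h => congrArg m (Fin.ext h)
  split_ifs <;> first
    | omega
    | rfl
    | (congr 1; apply hm; simp only [Fin.val_castSucc, Fin.val_succ]; omega)

/-- The multilinear map `(a₀, …, a_{q+1}) ↦ a₀ ⊗ ⋯ ⊗ aᵢ aᵢ₊₁ ⊗ ⋯ ⊗ a_{q+1}`, for `0 ≤ i ≤ q`. -/
def faceMultilinear (q : ℕ) (i : Fin (q + 1)) :
    MultilinearMap k (fun _ : Fin (q + 2) => A) (⨂[k]^(q + 1) A) where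
  toFun a := PiTensorProduct.tprod k (Fin.contractNth i.castSucc (· * ·) a)
  map_update_add' := by
    intro inst m j x y
    obtain rfl : inst = instDecidableEqFin _ := Subsingleton.elim _ _
    simp only [contractNth_update]
    rw [← MultilinearMap.map_update_add]
    split_ifs <;> simp only [add_mul, mul_add]
  map_update_smul' := by
    intro inst m j r x
    obtain rfl : inst = instDecidableEqFin _ := Subsingleton.elim _ _
    simp only [contractNth_update]
    rw [← MultilinearMap.map_update_smul]
    split_ifs <;> simp only [smul_mul_assoc, mul_smul_comm]

/-- The face map `dᵢ : A^{⊗(q+2)} → A^{⊗(q+1)}`, multiplying the entries `i` and `i + 1`. -/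
def face (q : ℕ) (i : Fin (q + 1)) : (⨂[k]^(q + 2) A) →ₗ[k] (⨂[k]^(q + 1) A) :=
  PiTensorProduct.lift (faceMultilinear k A q i)

/-- The rotation `a₀ ⊗ ⋯ ⊗ a_q ↦ a_q ⊗ a₀ ⊗ ⋯ ⊗ a_{q-1}`. -/
def rotation (q : ℕ) : (⨂[k]^(q + 1) A) →ₗ[k] (⨂[k]^(q + 1) A) :=
  (PiTensorProduct.reindex k (fun _ => A) (finRotate (q + 1))).toLinearMap

/-- The cyclic operator `t = (-1)^q` times the rotation. -/
def cyclicOperator (q : ℕ) : (⨂[k]^(q + 1) A) →ₗ[k] (⨂[k]^(q + 1) A) :=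
  (-1 : k) ^ q • rotation k A q

/-- The norm operator `N = 1 + t + ⋯ + t^q` on `A^{⊗(q+1)}`. -/
def normOperator (q : ℕ) : (⨂[k]^(q + 1) A) →ₗ[k] (⨂[k]^(q + 1) A) :=
  ∑ i ∈ Finset.range (q + 1), cyclicOperator k A q ^ i

/-- The bar differential `b' = ∑_{i=0}^{q} (-1)^i dᵢ : A^{⊗(q+2)} → A^{⊗(q+1)}`. -/
def barDifferential (q : ℕ) : (⨂[k]^(q + 2) A) →ₗ[k] (⨂[k]^(q + 1) A) :=
  ∑ i : Fin (q + 1), (-1 : k) ^ (i : ℕ) • face k A q i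

/-- The Hochschild differential `b = b' + (-1)^{q+1} d_{q+1}`, where the last face is
`d_{q+1} (a₀ ⊗ ⋯ ⊗ a_{q+1}) = a_{q+1} a₀ ⊗ a₁ ⊗ ⋯ ⊗ a_q`. -/
def hochschildDifferential (q : ℕ) : (⨂[k]^(q + 2) A) →ₗ[k] (⨂[k]^(q + 1) A) :=
  barDifferential k A q + (-1 : k) ^ (q + 1) • (face k A q 0 ∘ₗ rotation k A (q + 1))

/-- Degree `n` of the total complex of the cyclic bicomplex. The bicomplex has `A^{⊗(q+1)}` in
column `p` and row `q`, for all `p, q ≥ 0`; in total degree `n` the row `q` sits in column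
`p = n - q`. -/
abbrev Tot (n : ℕ) : Type _ := (q : Fin (n + 1)) → ⨂[k]^((q : ℕ) + 1) A

/-- The differential of the total complex. The even columns of the cyclic bicomplex carry the
vertical differential `b`, the odd ones `-b'`; the horizontal differential is `1 - t` from an odd
column to an even one, and `N` from an even column to an odd one. The component of the
differential in row `q`, that is in column `n - q`, collects the vertical differential from
row `q + 1` of the same column and the horizontal differential from the next column. -/
def differential (n : ℕ) : Tot k A (n + 1) →ₗ[k] Tot k A n :=
  LinearMap.pi fun q : Fin (n + 1) =>
    if Even (n - (q : ℕ)) then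
      hochschildDifferential k A q ∘ₗ LinearMap.proj q.succ +
        (LinearMap.id - cyclicOperator k A q) ∘ₗ LinearMap.proj q.castSucc
    else
      -(barDifferential k A q ∘ₗ LinearMap.proj q.succ) +
        normOperator k A q ∘ₗ LinearMap.proj q.castSucc

/-- The cycles of the total complex. -/
def cycles : (n : ℕ) → Submodule k (Tot k A n)
  | 0 => ⊤
  | n + 1 => LinearMap.ker (differential k A n)

/-- The boundaries of the total complex. -/
def boundaries (n : ℕ) : Submodule k (Tot k A n) := LinearMap.range (differential k A n)

/-- The cyclic homology `HCₙ(A)` of the `k`-algebra `A`: the homology of the total complex of the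
cyclic bicomplex. -/
abbrev HC (n : ℕ) : Type _ := cycles k A n ⧸ (boundaries k A n).submoduleOf (cycles k A n)

variable {A}

/-- The class in `HC₀(A) = A / [A, A]` of an element of `A`. -/
def classZero (a : A) : HC k A 0 :=
  Submodule.Quotient.mk ⟨fun _ => PiTensorProduct.tprod k fun _ => a, Submodule.mem_top⟩

end CyclicHomology

/-! ### Path algebras of quivers -/

namespace PathAlgebra

/-- The paths of a quiver, with all possible sources and targets. -/
abbrev AnyPath (V : Type u) [Quiver.{v} V] := Σ a b : V, Quiver.Path a b

end PathAlgebra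

/-- The path algebra of the quiver `V`: the free `k`-module on the set of all paths. -/
def PathAlgebra (k : Type w) [CommRing k] (V : Type u) [Quiver.{v} V] :=
  PathAlgebra.AnyPath V →₀ k

namespace PathAlgebra

variable (k : Type w) [CommRing k] (V : Type u) [Quiver.{v} V]

instance : AddCommGroup (PathAlgebra k V) := inferInstanceAs (AddCommGroup (AnyPath V →₀ k))

instance : Module k (PathAlgebra k V) := inferInstanceAs (Module k (AnyPath V →₀ k))

variable {V}

variable (V) in
/-- The basis of the path algebra consisting of all paths. -/
def pathBasis : Module.Basis (AnyPath V) k (PathAlgebra k V) :=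
  .ofRepr (LinearEquiv.refl k (AnyPath V →₀ k))

/-- The basis element of the path algebra given by a path. -/
def ofPath {a b : V} (p : Quiver.Path a b) : PathAlgebra k V :=
  pathBasis k V ⟨a, b, p⟩

open Classical in
/-- The product of two paths: their composite if the first ends where the second starts, and `0`
otherwise. -/
def pathMul (p q : AnyPath V) : PathAlgebra k V :=
  if h : q.1 = p.2.1 then ofPath k (p.2.2.comp (q.2.2.cast h rfl)) else 0

variable (V)

/-- The multiplication of the path algebra, the bilinear extension of `pathMul`. -/
def mulMap : PathAlgebra k V →ₗ[k] PathAlgebra k V →ₗ[k] PathAlgebra k V :=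
  (pathBasis k V).constr k fun p => (pathBasis k V).constr k fun q => pathMul k p q

instance : Mul (PathAlgebra k V) := ⟨fun x y => mulMap k V x y⟩

variable {V}

theorem mul_def (x y : PathAlgebra k V) : x * y = mulMap k V x y := rfl

theorem induction {P : PathAlgebra k V → Prop} (zero : P 0)
    (add : ∀ x y, P x → P y → P (x + y))
    (smul_path : ∀ (r : k) (p : AnyPath V), P (r • ofPath k p.2.2)) (x : PathAlgebra k V) : P x := by
  rw [← (pathBasis k V).linearCombination_repr x, Finsupp.linearCombination_apply]
  exact Finset.sum_induction _ P add zero fun p _ => smul_path _ p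

theorem ofPath_mul_ofPath (p q : AnyPath V) :
    ofPath k p.2.2 * ofPath k q.2.2 = pathMul k p q := by
  change mulMap k V (pathBasis k V p) (pathBasis k V q) = _
  rw [mulMap, Module.Basis.constr_basis, Module.Basis.constr_basis]

theorem ofPath_mul_comp {a b c : V} (p : Quiver.Path a b) (q : Quiver.Path b c) :
    ofPath k p * ofPath k q = ofPath k (p.comp q) := by
  rw [ofPath_mul_ofPath k ⟨a, b, p⟩ ⟨b, c, q⟩, pathMul, dif_pos rfl]
  rfl

theorem ofPath_mul_of_ne {a b c d : V} (p : Quiver.Path a b) (q : Quiver.Path c d) (h : c ≠ b) :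
    ofPath k p * ofPath k q = 0 := by
  rw [ofPath_mul_ofPath k ⟨a, b, p⟩ ⟨c, d, q⟩, pathMul, dif_neg h]

theorem pathMul_assoc (p q r : AnyPath V) :
    pathMul k p q * ofPath k r.2.2 = ofPath k p.2.2 * pathMul k q r := by
  obtain ⟨a, b, p⟩ := p
  obtain ⟨c, d, q⟩ := q
  obtain ⟨e, f, r⟩ := r
  rw [← ofPath_mul_ofPath, ← ofPath_mul_ofPath]
  by_cases h : c = b
  · subst h
    by_cases h' : e = d
    · subst h'
      simp only [ofPath_mul_comp, Quiver.Path.comp_assoc]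
    · rw [ofPath_mul_comp, ofPath_mul_of_ne k _ _ h', ofPath_mul_of_ne k _ _ h']
      exact (map_zero (mulMap k V _)).symm
  · rw [ofPath_mul_of_ne k _ _ h]
    by_cases h' : e = d
    · subst h'
      rw [ofPath_mul_comp, ofPath_mul_of_ne k _ _ h]
      exact LinearMap.map_zero₂ (mulMap k V) _
    · rw [ofPath_mul_of_ne k _ _ h']
      exact (LinearMap.map_zero₂ (mulMap k V) _).trans (map_zero (mulMap k V _)).symm

theorem mul_assoc_aux (x y z : PathAlgebra k V) : x * y * z = x * (y * z) := by
  simp only [mul_def]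
  induction x using PathAlgebra.induction with
  | zero => simp
  | add x x' hx hx' => simp only [map_add, LinearMap.add_apply, hx, hx']
  | smul_path r p =>
    induction y using PathAlgebra.induction with
    | zero => simp
    | add y y' hy hy' => simp only [map_add, LinearMap.add_apply, hy, hy']
    | smul_path s q =>
      induction z using PathAlgebra.induction with
      | zero => simp
      | add z z' hz hz' => simp only [map_add, hz, hz']
      | smul_path t l =>
        simp only [map_smul, LinearMap.smul_apply, ← mul_def]
        rw [ofPath_mul_ofPath, ofPath_mul_ofPath, pathMul_assoc]

instance : NonUnitalRing (PathAlgebra k V) :=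
  { (inferInstance : AddCommGroup (PathAlgebra k V)), (inferInstance : Mul (PathAlgebra k V)) with
    left_distrib := fun x y z => map_add (mulMap k V x) y z
    right_distrib := fun x y z => LinearMap.map_add₂ (mulMap k V) x y z
    zero_mul := fun x => LinearMap.map_zero₂ (mulMap k V) x
    mul_zero := fun x => map_zero (mulMap k V x)
    mul_assoc := mul_assoc_aux k }

instance : IsScalarTower k (PathAlgebra k V) (PathAlgebra k V) :=
  ⟨fun r x y => LinearMap.map_smul₂ (mulMap k V) r x y⟩

instance : SMulCommClass k (PathAlgebra k V) (PathAlgebra k V) :=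
  ⟨fun r x y => ((mulMap k V x).map_smul r y).symm⟩

variable (V)

/-- The two-sided ideal `𝔪` of the path algebra generated by the paths of length one. -/
def arrowIdeal : TwoSidedIdeal (PathAlgebra k V) :=
  TwoSidedIdeal.span {x | ∃ (a b : V) (e : a ⟶ b), x = ofPath k e.toPath}

variable {V}

theorem smul_mem_arrowIdeal (r : k) {x : PathAlgebra k V} (hx : x ∈ arrowIdeal k V) :
    r • x ∈ arrowIdeal k V := by
  induction hx using TwoSidedIdeal.span_induction with
  | mem x hx =>
    obtain ⟨a, b, e, rfl⟩ := hx
    have h : r • ofPath k e.toPath =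
        (r • ofPath k (Quiver.Path.nil : Quiver.Path a a)) * ofPath k e.toPath := by
      rw [smul_mul_assoc, ofPath_mul_comp, Quiver.Path.nil_comp]
    rw [h]
    exact TwoSidedIdeal.mul_mem_left _ _ _ (TwoSidedIdeal.subset_span ⟨a, b, e, rfl⟩)
  | zero => rw [smul_zero]; exact zero_mem _
  | add x y _ _ hx hy => rw [smul_add]; exact add_mem hx hy
  | neg x _ hx => rw [smul_neg]; exact neg_mem hx
  | left_absorb a x _ hx => rw [← mul_smul_comm]; exact TwoSidedIdeal.mul_mem_left _ _ _ hx
  | right_absorb b x _ hx => rw [← smul_mul_assoc]; exact TwoSidedIdeal.mul_mem_right _ _ _ hx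

variable (V)

/-- The quotient `kΓ / 𝔪` of the path algebra by the ideal generated by the arrows. -/
def ModArrows := (arrowIdeal k V).ringCon.Quotient

namespace ModArrows

instance : NonUnitalRing (ModArrows k V) :=
  inferInstanceAs (NonUnitalRing (arrowIdeal k V).ringCon.Quotient)

/-- The quotient map `kΓ → kΓ / 𝔪`. -/
def mk (x : PathAlgebra k V) : ModArrows k V := (x : (arrowIdeal k V).ringCon.Quotient)

variable {V}

theorem mk_surjective : Function.Surjective (mk k V) := Quotient.mk''_surjective

theorem mk_eq_mk_iff (x y : PathAlgebra k V) : mk k V x = mk k V y ↔ x - y ∈ arrowIdeal k V :=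
  (RingCon.eq _).trans (TwoSidedIdeal.rel_iff _ x y)

instance : SMul k (ModArrows k V) :=
  ⟨fun r => Quotient.map' (fun x : PathAlgebra k V => r • x) fun x y h => by
    have h' : (arrowIdeal k V).ringCon x y := h
    rw [TwoSidedIdeal.rel_iff] at h'
    change (arrowIdeal k V).ringCon (r • x) (r • y)
    rw [TwoSidedIdeal.rel_iff, ← smul_sub]
    exact smul_mem_arrowIdeal k r h'⟩

theorem smul_mk (r : k) (x : PathAlgebra k V) : r • mk k V x = mk k V (r • x) := rfl

theorem mk_add (x y : PathAlgebra k V) : mk k V (x + y) = mk k V x + mk k V y := rfl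

theorem mk_mul (x y : PathAlgebra k V) : mk k V (x * y) = mk k V x * mk k V y := rfl

instance : Module k (ModArrows k V) :=
  Function.Surjective.module k
    (⟨⟨mk k V, rfl⟩, fun _ _ => rfl⟩ : PathAlgebra k V →+ ModArrows k V) (mk_surjective k)
    fun _ _ => rfl

instance : IsScalarTower k (ModArrows k V) (ModArrows k V) :=
  ⟨fun r x y => by
    obtain ⟨x, rfl⟩ := mk_surjective k x
    obtain ⟨y, rfl⟩ := mk_surjective k y
    exact congrArg (mk k V) (smul_mul_assoc r x y)⟩

instance : SMulCommClass k (ModArrows k V) (ModArrows k V) :=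
  ⟨fun r x y => by
    obtain ⟨x, rfl⟩ := mk_surjective k x
    obtain ⟨y, rfl⟩ := mk_surjective k y
    exact congrArg (mk k V) (mul_smul_comm r x y).symm⟩

end ModArrows

end PathAlgebra

namespace Quiver

variable (V : Type u) [Quiver.{v} V]

/-- The (based, oriented) cycles of a quiver: the paths with the same source and target. -/
abbrev ClosedPath := Σ a : V, Quiver.Path a a

variable {V}

/-- The generator of the cyclic group action on closed paths: it moves the last arrow to the front.
A closed path of length zero is fixed. -/
def ClosedPath.rotate : ClosedPath V → ClosedPath V
  | ⟨a, .nil⟩ => ⟨a, .nil⟩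
  | ⟨_, .cons (b := b) p e⟩ => ⟨b, e.toPath.comp p⟩

variable (V)

/-- The orbits of the closed paths of a quiver under rotation. -/
def CycleOrbit := Quot fun γ γ' : ClosedPath V => γ' = γ.rotate

end Quiver

end

/-! Since `k` contains `ℚ`, the operators `1 - t` and `N` are exact on each row of the cyclic
bicomplex. A cycle of the total complex is therefore controlled by its component in column zero,
taken modulo the image of `1 - t`, which is a chain of Connes' complex. This is
`mem_boundaries_of_last_eq_zero`, which rests on `exists_sum_pow_eq` and `exists_sub_eq`.

A basis of paths turns chains into combinations of words of paths. Let `h` be the signed sum of all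
ways of splitting one letter of a word into two paths. A path of length `m` has `m + 1` splittings,
each of which multiplies back to the path, and a splitting of a composite at the joint of its
factors is counted once from either side. Hence, modulo the image of `1 - t`, the operator `b h + h
b` multiplies a word of at least two letters by its weight: the total length plus the number of
cyclically consecutive letters that do not compose (`hoch_homotopy`). The differential preserves the
weight, and positive weights are invertible, so in positive degree only weight zero contributes
(`exists_hoch_of_hoch_mem`).

A nonempty word of weight zero repeats the idempotent of one vertex. In odd degree `t` acts on it by
`-1`, so it dies in the cyclic quotient. In even degree it survives, and it extends to a cycle of
the total complex (`exists_cycle`). This gives one generator for each vertex. The homotopy formula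
needs two letters, so degree zero is computed directly: modulo commutators open paths vanish, and
closed paths are identified under rotation.

The argument uses only a basis that multiplies like paths (`IsPathBasis`). It therefore applies both
to `kΓ` and to `kΓ / 𝔪`, the latter with the vertices regarded as a quiver without arrows. -/

noncomputable section

open scoped TensorProduct

universe u v w

/-! ### Splittings of paths -/

namespace Quiver.Path

variable {V : Type u} [Quiver.{v} V]

/-- All the ways of writing a path as the composite of two paths. -/
def splittings {a : V} : ∀ {b : V}, Path a b → List (Σ c : V, Path a c × Path c b)
  | _, .nil => [⟨a, .nil, .nil⟩]
  | _, .cons p e => p.splittings.map (fun s => ⟨s.1, s.2.1, s.2.2.cons e⟩) ++ [⟨_, p.cons e, .nil⟩]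

theorem comp_of_mem_splittings {a b : V} (p : Path a b) :
    ∀ s ∈ p.splittings, s.2.1.comp s.2.2 = p := by
  induction p with
  | nil => simp [splittings]
  | cons p e ih =>
    intro s hs
    simp only [splittings, List.mem_append, List.mem_map, List.mem_singleton] at hs
    obtain ⟨t, ht, rfl⟩ | rfl := hs
    · simp [ih t ht]
    · simp

theorem length_splittings {a b : V} (p : Path a b) : p.splittings.length = p.length + 1 := by
  induction p with
  | nil => simp [splittings]
  | cons p e ih => simp [splittings, ih]

/-- The splittings of a composite: those of the two factors, with the obvious one counted twice. -/
theorem sum_splittings_comp {G : Type*} [AddCommMonoid G] {a b c : V} (p : Path a b) (q : Path b c)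
    (f : (Σ d : V, Path a d × Path d c) → G) :
    ((p.comp q).splittings.map f).sum + f ⟨b, p, q⟩ =
      (p.splittings.map fun s => f ⟨s.1, s.2.1, s.2.2.comp q⟩).sum +
        (q.splittings.map fun s => f ⟨s.1, p.comp s.2.1, s.2.2⟩).sum := by
  induction q with
  | nil => simp [splittings]
  | cons q e ih =>
    have := ih fun s => f ⟨s.1, s.2.1, s.2.2.cons e⟩
    simp only [comp_cons, splittings, List.map_append, List.map_map, List.sum_append,
      List.map_singleton, List.sum_singleton, Function.comp_def] at this ⊢
    rw [add_right_comm, this, add_assoc]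

end Quiver.Path

/-! ### Composition of paths with arbitrary endpoints -/

namespace PathAlgebra

namespace AnyPath

variable {V : Type u} [Quiver.{v} V]

/-- The first path ends where the second starts. -/
abbrev Composable (p q : AnyPath V) : Prop := p.2.1 = q.1

open Classical in
/-- The composite of two paths (the first path if they are not composable). -/
def comp (p q : AnyPath V) : AnyPath V :=
  if h : q.1 = p.2.1 then ⟨p.1, q.2.1, p.2.2.comp (q.2.2.cast h rfl)⟩ else p

@[simp]
theorem comp_mk {a b c : V} (p : Quiver.Path a b) (q : Quiver.Path b c) :
    comp (⟨a, b, p⟩ : AnyPath V) ⟨b, c, q⟩ = ⟨a, c, p.comp q⟩ := by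
  simp [comp]

@[simp]
theorem comp_fst (p q : AnyPath V) : (comp p q).1 = p.1 := by
  unfold comp; split_ifs <;> rfl

theorem Composable.comp_snd {p q : AnyPath V} (h : p.Composable q) : (comp p q).2.1 = q.2.1 := by
  unfold comp; rw [dif_pos h.symm]

/-- The number of arrows of a path. -/
abbrev length (p : AnyPath V) : ℕ := p.2.2.length

theorem Composable.length_comp {p q : AnyPath V} (h : p.Composable q) :
    (comp p q).length = p.length + q.length := by
  obtain ⟨a, b, p⟩ := p
  obtain ⟨b', c, q⟩ := q
  obtain rfl : b = b' := h
  rw [comp_mk]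
  exact Quiver.Path.length_comp p q

theorem comp_comp {p q r : AnyPath V} (h : p.Composable q) (h' : q.Composable r) :
    comp (comp p q) r = comp p (comp q r) := by
  obtain ⟨a, b, p⟩ := p
  obtain ⟨b', c, q⟩ := q
  obtain ⟨c', d, r⟩ := r
  obtain rfl : b = b' := h
  obtain rfl : c = c' := h'
  simp

end AnyPath

open AnyPath

/-! ### The free module on words of paths -/

/-- The free module on the words in the paths of a quiver. -/
abbrev Words (k : Type w) [CommRing k] (V : Type u) [Quiver.{v} V] := List (AnyPath V) →₀ k

namespace Words

variable (k : Type w) [CommRing k] {V : Type u} [Quiver.{v} V]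

/-- The basis element given by a word. -/
abbrev word (l : List (AnyPath V)) : Words k V := Finsupp.single l 1

/-- The span of a set of words. -/
def wordSpan (s : Set (List (AnyPath V))) : Submodule k (Words k V) :=
  Submodule.span k (word k '' s)

variable {k}

theorem word_mem {s : Set (List (AnyPath V))} {l : List (AnyPath V)} (h : l ∈ s) :
    word k l ∈ wordSpan k s :=
  Submodule.subset_span ⟨l, h, rfl⟩

variable {N : Type*} [AddCommGroup N] [Module k N]

/-- The linear map with prescribed values on words. -/
def lift (f : List (AnyPath V) → N) : Words k V →ₗ[k] N := Finsupp.linearCombination k f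

@[simp]
theorem lift_word (f : List (AnyPath V) → N) (l : List (AnyPath V)) :
    lift f (word k l) = f l := by
  simp [lift]

theorem hom_ext {f g : Words k V →ₗ[k] N} (h : ∀ l, f (word k l) = g (word k l)) : f = g :=
  Finsupp.lhom_ext' fun l => LinearMap.ext_ring (h l)

theorem map_mem {f : Words k V →ₗ[k] N} {s : Set (List (AnyPath V))} {S : Submodule k N}
    (h : ∀ l ∈ s, f (word k l) ∈ S) {z : Words k V} (hz : z ∈ wordSpan k s) : f z ∈ S := by
  have : wordSpan k s ≤ S.comap f := Submodule.span_le.2 (by rintro _ ⟨l, hl, rfl⟩; exact h l hl)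
  exact this hz

theorem eq_of_mem {f g : Words k V →ₗ[k] N} {s : Set (List (AnyPath V))}
    (h : ∀ l ∈ s, f (word k l) = g (word k l)) {z : Words k V} (hz : z ∈ wordSpan k s) :
    f z = g z :=
  LinearMap.eqOn_span (by rintro _ ⟨l, hl, rfl⟩; exact h l hl) hz

variable (k V) in
/-- The span of the words of length `n`. -/
def homogeneous (n : ℕ) : Submodule k (Words k V) := wordSpan k {l | l.length = n}

theorem word_mem_homogeneous {n : ℕ} {l : List (AnyPath V)} (h : l.length = n) :
    word k l ∈ homogeneous k V n :=
  word_mem h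

/-- Adding a letter in front. -/
def consM (p : AnyPath V) : Words k V →ₗ[k] Words k V := lift fun l => word k (p :: l)

/-- Adding a letter at the end. -/
def appM (p : AnyPath V) : Words k V →ₗ[k] Words k V := lift fun l => word k (l ++ [p])

open Classical in
/-- Multiplying the first letter by a path from the left. -/
def mulHead (p : AnyPath V) : Words k V →ₗ[k] Words k V :=
  lift fun
    | [] => 0
    | q :: l => if p.Composable q then word k (comp p q :: l) else 0

@[simp]
theorem consM_word (p : AnyPath V) (l : List (AnyPath V)) :
    consM p (word k l) = word k (p :: l) := by simp [consM]

@[simp]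
theorem appM_word (p : AnyPath V) (l : List (AnyPath V)) :
    appM p (word k l) = word k (l ++ [p]) := by simp [appM]

theorem appM_consM (p q : AnyPath V) (m : Words k V) : appM p (consM q m) = consM q (appM p m) :=
  LinearMap.congr_fun (hom_ext (f := appM p ∘ₗ consM q) (g := consM q ∘ₗ appM p) (by simp)) m

@[simp]
theorem mulHead_nil (p : AnyPath V) : mulHead p (word k []) = 0 := by simp [mulHead]

open Classical in
theorem mulHead_consM (p q : AnyPath V) (m : Words k V) :
    mulHead p (consM q m) = if p.Composable q then consM (comp p q) m else 0 := by
  by_cases h : p.Composable q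
  · rw [if_pos h]
    refine LinearMap.congr_fun (hom_ext (f := mulHead p ∘ₗ consM q) fun l => ?_) m
    simp only [LinearMap.comp_apply, consM_word, mulHead, lift_word, if_pos h]
  · rw [if_neg h]
    refine LinearMap.congr_fun (hom_ext (f := mulHead p ∘ₗ consM q) (g := 0) fun l => ?_) m
    simp only [LinearMap.comp_apply, consM_word, mulHead, lift_word, if_neg h,
      LinearMap.zero_apply]

theorem mulHead_consM_of {p q : AnyPath V} (h : p.Composable q) (m : Words k V) :
    mulHead p (consM q m) = consM (comp p q) m := by
  rw [mulHead_consM, if_pos h]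

theorem mulHead_consM_of_not {p q : AnyPath V} (h : ¬ p.Composable q) (m : Words k V) :
    mulHead p (consM q m) = 0 := by
  rw [mulHead_consM, if_neg h]

open Classical in
theorem mulHead_mulHead (p q : AnyPath V) (m : Words k V) :
    mulHead p (mulHead q m) = if p.Composable q then mulHead (comp p q) m else 0 := by
  have key : ∀ l, mulHead p (mulHead q (word k l)) =
      if p.Composable q then mulHead (comp p q) (word k l) else 0 := by
    intro l
    cases l with
    | nil => simp
    | cons r l =>
      rw [← consM_word]
      by_cases h : p.Composable q <;> by_cases h' : q.Composable r
      · rw [if_pos h, mulHead_consM_of h', mulHead_consM_of (h.trans (comp_fst q r).symm),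
          mulHead_consM_of (h.comp_snd.trans h'), comp_comp h h']
      · rw [if_pos h, mulHead_consM_of_not h', map_zero,
          mulHead_consM_of_not fun h'' => h' (h.comp_snd.symm.trans h'')]
      · rw [if_neg h, mulHead_consM_of h',
          mulHead_consM_of_not fun h'' => h (h''.trans (comp_fst q r))]
      · rw [if_neg h, mulHead_consM_of_not h', map_zero]
  split_ifs at key ⊢ with h
  · exact LinearMap.congr_fun (hom_ext (f := mulHead p ∘ₗ mulHead q) key) m
  · exact LinearMap.congr_fun (hom_ext (f := mulHead p ∘ₗ mulHead q) (g := 0) key) m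

theorem consM_mem (p : AnyPath V) {n : ℕ} {m : Words k V} (hm : m ∈ homogeneous k V n) :
    consM p m ∈ homogeneous k V (n + 1) :=
  map_mem (fun l (hl : _ = _) => by rw [consM_word]; exact word_mem (by simp [hl])) hm

theorem appM_mem (p : AnyPath V) {n : ℕ} {m : Words k V} (hm : m ∈ homogeneous k V n) :
    appM p m ∈ homogeneous k V (n + 1) :=
  map_mem (fun l (hl : _ = _) => by rw [appM_word]; exact word_mem (by simp [hl])) hm

theorem mulHead_mem (p : AnyPath V) {n : ℕ} {m : Words k V} (hm : m ∈ homogeneous k V n) :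
    mulHead p m ∈ homogeneous k V n := by
  refine map_mem (fun l (hl : _ = _) => ?_) hm
  cases l with
  | nil => rw [mulHead_nil]; exact zero_mem _
  | cons q l =>
    rw [← consM_word, mulHead_consM]
    split_ifs
    · rw [consM_word]; exact word_mem (by simpa using hl)
    · exact zero_mem _

/-- Rotation of a word, moving the last letter to the front. -/
def rotateWord (l : List (AnyPath V)) : List (AnyPath V) := l.getLast?.toList ++ l.dropLast

@[simp]
theorem rotateWord_append (l : List (AnyPath V)) (x : AnyPath V) :
    rotateWord (l ++ [x]) = x :: l := by simp [rotateWord]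

variable (k V) in
/-- The signed rotation. -/
def rot : Words k V →ₗ[k] Words k V :=
  lift fun l => (-1 : k) ^ (l.length - 1) • word k (rotateWord l)

theorem rot_nil : rot k V (word k []) = word k [] := by
  rw [rot, lift_word]; simp [rotateWord]

theorem rot_append (l : List (AnyPath V)) (x : AnyPath V) :
    rot k V (word k (l ++ [x])) = (-1 : k) ^ l.length • word k (x :: l) := by
  rw [rot, lift_word, rotateWord_append]; simp

theorem rot_appM (x : AnyPath V) {n : ℕ} {m : Words k V} (hm : m ∈ homogeneous k V n) :
    rot k V (appM x m) = (-1 : k) ^ n • consM x m :=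
  eq_of_mem (f := rot k V ∘ₗ appM x) (g := (-1 : k) ^ n • consM x) (fun l (hl : _ = _) => by
    simp only [LinearMap.comp_apply, appM_word, rot_append, LinearMap.smul_apply, consM_word,
      hl]) hm

theorem rot_mem {n : ℕ} {m : Words k V} (hm : m ∈ homogeneous k V n) :
    rot k V m ∈ homogeneous k V n := by
  refine map_mem (fun l (hl : _ = _) => ?_) hm
  obtain rfl | ⟨l, x, rfl⟩ := l.eq_nil_or_concat'
  · rw [rot_nil]; exact word_mem hl
  · rw [rot_append]; exact Submodule.smul_mem _ _ (word_mem (by simpa using hl))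

variable (k V) in
/-- The product of the first two letters. -/
def mergeHead : Words k V →ₗ[k] Words k V :=
  lift fun
    | [] => 0
    | p :: l => mulHead p (word k l)

theorem mergeHead_nil : mergeHead k V (word k []) = 0 := by simp [mergeHead]

theorem mergeHead_consM (p : AnyPath V) (m : Words k V) :
    mergeHead k V (consM p m) = mulHead p m :=
  LinearMap.congr_fun (hom_ext (f := mergeHead k V ∘ₗ consM p) fun l => by
    rw [LinearMap.comp_apply, consM_word, mergeHead, lift_word]) m

/-! ### The bar and Hochschild differentials -/

variable (k V) in
/-- The bar differential on words. -/
def bar : Words k V →ₗ[k] Words k V :=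
  lift fun l => l.rec 0 fun p l b => mulHead p (word k l) - consM p b

theorem bar_nil : bar k V (word k []) = 0 := by simp [bar]

/-- This recursion on the first letter replaces the alternating sum of faces, so that identities
follow by induction on the word. The alternating sum is recovered in `bar_eq_sum`. -/
theorem bar_consM (p : AnyPath V) (m : Words k V) :
    bar k V (consM p m) = mulHead p m - consM p (bar k V m) :=
  LinearMap.congr_fun (hom_ext (f := bar k V ∘ₗ consM p)
    (g := mulHead p - consM p ∘ₗ bar k V) fun l => by
      simp only [LinearMap.comp_apply, LinearMap.sub_apply, consM_word, bar, lift_word]) m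

theorem bar_singleton (p : AnyPath V) : bar k V (word k [p]) = 0 := by
  rw [← consM_word, bar_consM, bar_nil, mulHead_nil, map_zero, sub_zero]

theorem bar_mem {n : ℕ} {m : Words k V} (hm : m ∈ homogeneous k V (n + 1)) :
    bar k V m ∈ homogeneous k V n := by
  induction n generalizing m with
  | zero =>
    refine map_mem (fun l (hl : _ = _) => ?_) hm
    obtain ⟨p, rfl⟩ := List.length_eq_one_iff.1 hl
    rw [bar_singleton]; exact zero_mem _
  | succ n ih =>
    refine map_mem (fun l (hl : _ = _) => ?_) hm
    obtain - | ⟨p, l⟩ := l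
    · simp at hl
    · have hl' : word k l ∈ homogeneous k V (n + 1) := word_mem (by simpa using hl)
      rw [← consM_word, bar_consM]
      exact sub_mem (mulHead_mem p hl') (consM_mem p (ih hl'))

theorem bar_mulHead (p : AnyPath V) (m : Words k V) :
    bar k V (mulHead p m) = mulHead p (bar k V m) := by
  refine LinearMap.congr_fun (hom_ext (f := bar k V ∘ₗ mulHead p) (g := mulHead p ∘ₗ bar k V)
    fun l => ?_) m
  simp only [LinearMap.comp_apply]
  cases l with
  | nil => rw [bar_nil, mulHead_nil, map_zero, map_zero]
  | cons q l =>
    rw [← consM_word, bar_consM, map_sub, mulHead_consM, mulHead_consM, mulHead_mulHead]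
    split_ifs
    · rw [bar_consM]
    · rw [map_zero, sub_zero]

theorem bar_bar (m : Words k V) : bar k V (bar k V m) = 0 := by
  refine LinearMap.congr_fun (hom_ext (f := bar k V ∘ₗ bar k V) (g := 0) fun l => ?_) m
  simp only [LinearMap.comp_apply, LinearMap.zero_apply]
  induction l with
  | nil => rw [bar_nil, map_zero]
  | cons p l ih =>
    rw [← consM_word, bar_consM, map_sub, bar_consM, bar_mulHead, ih, map_zero, sub_zero, sub_self]

theorem mulHead_append {l : List (AnyPath V)} (hl : l ≠ []) (p x : AnyPath V) :
    mulHead p (word k (l ++ [x])) = appM x (mulHead p (word k l)) := by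
  obtain ⟨q, l, rfl⟩ := List.exists_cons_of_ne_nil hl
  rw [List.cons_append, ← consM_word, ← consM_word, mulHead_consM, mulHead_consM]
  split_ifs
  · rw [consM_word, consM_word, appM_word, List.cons_append]
  · rw [map_zero]

-- The recursion seen from the other end of the word. It is needed because rotation removes the last
-- letter, while `bar` is defined through the first.
open Classical in
theorem bar_append (l : List (AnyPath V)) (y x : AnyPath V) :
    bar k V (word k (l ++ [y, x])) = appM x (bar k V (word k (l ++ [y]))) +
      (-1 : k) ^ l.length • if y.Composable x then word k (l ++ [comp y x]) else 0 := by
  induction l with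
  | nil =>
    simp only [List.nil_append, bar_singleton, map_zero, zero_add, List.length_nil, pow_zero,
      one_smul]
    rw [← consM_word, bar_consM, bar_singleton, map_zero, sub_zero, ← consM_word, mulHead_consM]
    simp only [consM_word]
  | cons p l ih =>
    simp only [List.cons_append, List.length_cons]
    rw [← consM_word, bar_consM, ih, ← consM_word p (l ++ [y]), bar_consM,
      List.append_cons, mulHead_append (by simp), map_sub, appM_consM, map_add, map_smul, pow_succ]
    split_ifs
    · rw [consM_word]; module
    · simp

variable (k V) in
/-- The Hochschild differential on words. -/
def hoch : Words k V →ₗ[k] Words k V := bar k V + mergeHead k V ∘ₗ rot k V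

/-- The last Hochschild face is the first face after a rotation, and the sign built into `rot` is
exactly the sign of that face. -/
theorem hoch_apply (m : Words k V) : hoch k V m = bar k V m + mergeHead k V (rot k V m) := rfl

theorem hoch_nil : hoch k V (word k []) = 0 := by
  rw [hoch_apply, bar_nil, rot_nil, mergeHead_nil, zero_add]

theorem mergeHead_rot_singleton (p : AnyPath V) : mergeHead k V (rot k V (word k [p])) = 0 := by
  rw [← List.nil_append [p], rot_append, map_smul, ← consM_word, mergeHead_consM, mulHead_nil,
    smul_zero]

theorem hoch_singleton (p : AnyPath V) : hoch k V (word k [p]) = 0 := by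
  rw [hoch_apply, bar_singleton, mergeHead_rot_singleton, zero_add]

theorem mergeHead_rot_append (l : List (AnyPath V)) (x : AnyPath V) :
    mergeHead k V (rot k V (word k (l ++ [x]))) = (-1 : k) ^ l.length • mulHead x (word k l) := by
  rw [rot_append, map_smul, ← consM_word, mergeHead_consM]

theorem mergeHead_rot_appM (x : AnyPath V) {n : ℕ} {m : Words k V} (hm : m ∈ homogeneous k V n) :
    mergeHead k V (rot k V (appM x m)) = (-1 : k) ^ n • mulHead x m := by
  rw [rot_appM x hm, map_smul, mergeHead_consM]

/-- Case distinction on the length of a word, with the last two letters split off. -/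
theorem word_cases {P : List (AnyPath V) → Prop} (nil : P []) (singleton : ∀ x, P [x])
    (append : ∀ l y x, P (l ++ [y, x])) (l : List (AnyPath V)) : P l := by
  obtain rfl | ⟨l, x, rfl⟩ := l.eq_nil_or_concat'
  · exact nil
  obtain rfl | ⟨l, y, rfl⟩ := l.eq_nil_or_concat'
  · exact singleton x
  · simpa using append l y x

/-- Subtracted from the definition of `hoch`, this is the relation `b (1 - t) = (1 - t) b'`. -/
theorem hoch_rot (m : Words k V) :
    hoch k V (rot k V m) = mergeHead k V (rot k V m) + rot k V (bar k V m) := by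
  refine LinearMap.congr_fun (hom_ext (f := hoch k V ∘ₗ rot k V)
    (g := mergeHead k V ∘ₗ rot k V + rot k V ∘ₗ bar k V) fun l => ?_) m
  simp only [LinearMap.comp_apply, LinearMap.add_apply]
  induction l using word_cases with
  | nil => rw [rot_nil, hoch_nil, bar_nil, mergeHead_nil, map_zero, zero_add]
  | singleton x =>
    rw [mergeHead_rot_singleton, bar_singleton, map_zero, zero_add, ← List.nil_append [x],
      rot_append, map_smul, hoch_singleton, smul_zero]
  | append l y x =>
    have hb : bar k V (word k (l ++ [y])) ∈ homogeneous k V l.length :=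
      bar_mem (word_mem (by simp))
    have he : l ++ [y, x] = l ++ [y] ++ [x] := by simp
    rw [bar_append, map_add, rot_appM x hb, he, mergeHead_rot_append, rot_append,
      map_smul, hoch_apply, ← List.cons_append, mergeHead_rot_append, List.cons_append,
      ← consM_word, bar_consM, ← consM_word x l, mulHead_consM, map_smul, apply_ite (rot k V),
      rot_append, map_zero, List.length_append, List.length_singleton, List.length_cons]
    obtain h | h := neg_one_pow_eq_or k l.length <;> split_ifs <;>
      simp only [pow_succ, h, consM_word] <;> module

theorem hoch_hoch (m : Words k V) : hoch k V (hoch k V m) = 0 := by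
  refine LinearMap.congr_fun (hom_ext (f := hoch k V ∘ₗ hoch k V) (g := 0) fun l => ?_) m
  simp only [LinearMap.comp_apply, LinearMap.zero_apply]
  induction l using word_cases with
  | nil => rw [hoch_nil, map_zero]
  | singleton x => rw [hoch_singleton, map_zero]
  | append l y x =>
    have hb : bar k V (word k (l ++ [y])) ∈ homogeneous k V l.length :=
      bar_mem (word_mem (by simp))
    have he : l ++ [y, x] = l ++ [y] ++ [x] := by simp
    -- The last face taken twice; it cancels against the last face of the word ending in the product
    -- `y x`. For empty `l` both sides vanish, because a single letter has no face.
    have h1 : mergeHead k V (rot k V (mulHead x (word k (l ++ [y])))) =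
        (-1 : k) ^ l.length • mulHead y (mulHead x (word k l)) := by
      obtain rfl | hl := eq_or_ne l []
      · rw [mulHead_nil, map_zero, smul_zero, List.nil_append, ← consM_word, mulHead_consM]
        split_ifs
        · rw [consM_word, mergeHead_rot_singleton]
        · rw [map_zero, map_zero]
      · rw [mulHead_append hl, mergeHead_rot_appM _ (mulHead_mem _ (word_mem rfl))]
    rw [hoch_apply (word k _), map_add, hoch_apply (bar k V _), bar_bar, zero_add, bar_append,
      map_add, map_add, mergeHead_rot_appM x hb, he, mergeHead_rot_append, hoch_apply]
    simp only [map_smul]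
    rw [h1, bar_mulHead, mulHead_mulHead, apply_ite (rot k V), apply_ite (mergeHead k V),
      mergeHead_rot_append, map_zero, map_zero, List.length_append, List.length_singleton]
    split_ifs <;> simp only [pow_succ] <;> module

/-! ### The contracting homotopy -/

theorem map_list_sum_map {N N' : Type*} [AddCommGroup N] [Module k N] [AddCommGroup N']
    [Module k N'] (f : N →ₗ[k] N') {ι : Type*} (L : List ι) (g : ι → N) :
    f (L.map g).sum = (L.map fun i => f (g i)).sum := by
  rw [map_list_sum, List.map_map, Function.comp_def]

theorem sum_map_sub {N ι : Type*} [AddCommGroup N] (L : List ι) (f g : ι → N) :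
    (L.map fun i => f i - g i).sum = (L.map f).sum - (L.map g).sum := by
  induction L with
  | nil => simp
  | cons i L ih => simp only [List.map_cons, List.sum_cons, ih]; abel

/-- The words obtained by putting `p` in front and splitting it in all possible ways. -/
def split (p : AnyPath V) : Words k V →ₗ[k] Words k V :=
  (p.2.2.splittings.map fun s => consM ⟨_, _, s.2.1⟩ ∘ₗ consM ⟨_, _, s.2.2⟩).sum

theorem split_apply (p : AnyPath V) (m : Words k V) :
    split p m =
      (p.2.2.splittings.map fun s => consM ⟨_, _, s.2.1⟩ (consM ⟨_, _, s.2.2⟩ m)).sum := by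
  rw [split]
  induction p.2.2.splittings with
  | nil => simp
  | cons s L ih => simp [ih]

/-- The second halves of the splittings of `p` are multiplied with the word, the first ones put in
front. -/
def splitMul (p : AnyPath V) (m : Words k V) : Words k V :=
  (p.2.2.splittings.map fun s => consM ⟨_, _, s.2.1⟩ (mulHead ⟨_, _, s.2.2⟩ m)).sum

/-- The weight originates here: each of the `p.length + 1` splittings multiplies back to `p`. -/
theorem bar_split (p : AnyPath V) (m : Words k V) :
    bar k V (split p m) = (p.length + 1 : k) • consM p m - splitMul p m + split p (bar k V m) := by
  have h : ∀ s ∈ p.2.2.splittings, bar k V (consM ⟨_, _, s.2.1⟩ (consM ⟨_, _, s.2.2⟩ m)) =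
      consM p m - (consM ⟨_, _, s.2.1⟩ (mulHead ⟨_, _, s.2.2⟩ m) -
        consM ⟨_, _, s.2.1⟩ (consM ⟨_, _, s.2.2⟩ (bar k V m))) := by
    intro s hs
    rw [bar_consM, mulHead_consM_of rfl, comp_mk, p.2.2.comp_of_mem_splittings s hs, bar_consM,
      map_sub]
  rw [split_apply, map_list_sum_map, List.map_congr_left h, sum_map_sub, sum_map_sub, split_apply,
    splitMul, List.map_const', List.sum_replicate, Quiver.Path.length_splittings,
    ← Nat.cast_smul_eq_nsmul k]
  push_cast
  abel

-- The Leibniz rule for splittings. The splitting of `p q` at the joint arises from both factors,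
-- and the surplus word `p, q` lowers the eigenvalue of the homotopy by one for each composable
-- pair.
open Classical in
theorem mulHead_split (p q : AnyPath V) (m : Words k V) :
    splitMul p (consM q m) + mulHead p (split q m) =
      if p.Composable q then split (comp p q) m + consM p (consM q m) else 0 := by
  obtain ⟨a, b, p⟩ := p
  obtain ⟨b', c, q⟩ := q
  rw [split_apply, map_list_sum_map, splitMul]
  split_ifs with h
  · obtain rfl : b = b' := h
    rw [comp_mk, split_apply]
    refine Eq.trans ?_ (Quiver.Path.sum_splittings_comp p q fun s =>
      consM ⟨_, _, s.2.1⟩ (consM ⟨_, _, s.2.2⟩ m)).symm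
    congr 3 <;> funext s <;> rw [mulHead_consM_of rfl, comp_mk]
  · have h1 : ∀ s ∈ p.splittings, consM (⟨a, s.1, s.2.1⟩ : AnyPath V)
        (mulHead ⟨s.1, b, s.2.2⟩ (consM ⟨b', c, q⟩ m)) = 0 := fun s _ => by
      rw [mulHead_consM_of_not (p := ⟨s.1, b, s.2.2⟩) (q := ⟨b', c, q⟩) h, map_zero]
    have h2 : ∀ s ∈ q.splittings, mulHead (⟨a, b, p⟩ : AnyPath V)
        (consM ⟨b', s.1, s.2.1⟩ (consM ⟨s.1, c, s.2.2⟩ m)) = 0 := fun s _ =>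
      mulHead_consM_of_not (p := ⟨a, b, p⟩) (q := ⟨b', s.1, s.2.1⟩) h _
    rw [List.map_congr_left h1, List.map_congr_left h2]
    simp

theorem split_mem (p : AnyPath V) {n : ℕ} {m : Words k V} (hm : m ∈ homogeneous k V n) :
    split p m ∈ homogeneous k V (n + 2) := by
  rw [split_apply]
  refine list_sum_mem fun y hy => ?_
  obtain ⟨s, _, rfl⟩ := List.mem_map.1 hy
  exact consM_mem _ (consM_mem _ hm)

variable (k V) in
/-- The homotopy: splitting the letters of a word one at a time. -/
def homotopy : Words k V →ₗ[k] Words k V :=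
  lift fun l => l.rec 0 fun p l b => split p (word k l) - consM p b

theorem homotopy_nil : homotopy k V (word k []) = 0 := by simp [homotopy]

theorem homotopy_consM (p : AnyPath V) (m : Words k V) :
    homotopy k V (consM p m) = split p m - consM p (homotopy k V m) :=
  LinearMap.congr_fun (hom_ext (f := homotopy k V ∘ₗ consM p)
    (g := split p - consM p ∘ₗ homotopy k V) fun l => by
      simp only [LinearMap.comp_apply, LinearMap.sub_apply, consM_word, homotopy, lift_word]) m

theorem homotopy_mem {n : ℕ} {m : Words k V} (hm : m ∈ homogeneous k V n) :
    homotopy k V m ∈ homogeneous k V (n + 1) := by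
  induction n generalizing m with
  | zero =>
    refine map_mem (fun l (hl : _ = _) => ?_) hm
    rw [List.length_eq_zero_iff.1 hl, homotopy_nil]; exact zero_mem _
  | succ n ih =>
    refine map_mem (fun l (hl : _ = _) => ?_) hm
    obtain - | ⟨p, l⟩ := l
    · simp at hl
    · have hl' : word k l ∈ homogeneous k V n := word_mem (by simpa using hl)
      rw [← consM_word, homotopy_consM]
      exact sub_mem (split_mem p hl') (consM_mem p (ih hl'))

open Classical in
/-- Whether two vertices are different, as a number. -/
def jump (a b : V) : ℕ := if a = b then 0 else 1

theorem _root_.PathAlgebra.AnyPath.Composable.jump_eq_zero {p q : AnyPath V}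
    (h : p.Composable q) : jump p.2.1 q.1 = 0 :=
  if_pos h

/-- The total length of the paths of a word, plus its length, minus the number of composable
consecutive letters. -/
def linearWeight : List (AnyPath V) → ℕ
  | [] => 0
  | [p] => p.length + 1
  | p :: q :: l => p.length + jump p.2.1 q.1 + linearWeight (q :: l)

-- Each letter contributes its number of splittings, and each composable pair of neighbours takes
-- one back by `mulHead_split`. All other terms cancel in the induction.
open Classical in
theorem bar_homotopy (l : List (AnyPath V)) :
    bar k V (homotopy k V (word k l)) + homotopy k V (bar k V (word k l)) =
      (linearWeight l : k) • word k l := by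
  induction l with
  | nil => simp [homotopy_nil, bar_nil, linearWeight]
  | cons p l ih =>
    obtain - | ⟨q, l⟩ := l
    · rw [bar_singleton, ← consM_word, homotopy_consM, homotopy_nil, map_zero, sub_zero, bar_split,
        bar_nil, splitMul]
      simp [linearWeight]
    · have h := mulHead_split p q (word k l)
      rw [← consM_word p, homotopy_consM, bar_consM, map_sub, map_sub, bar_split, bar_consM,
        homotopy_consM]
      rw [← eq_sub_iff_add_eq] at ih
      rw [ih, ← consM_word q, homotopy_consM, map_sub, mulHead_consM, mulHead_consM, linearWeight,
        consM_word q,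
        show jump p.2.1 q.1 = if p.Composable q then 0 else 1 from rfl]
      rw [← eq_sub_iff_add_eq, consM_word] at h
      rw [h]
      split_ifs
      · rw [homotopy_consM]
        simp only [map_sub, map_smul, consM_word]
        push_cast
        module
      · simp only [map_sub, map_smul, map_zero, consM_word]
        push_cast
        module

variable (k V) in
/-- The image of `1 - t` on words of length `n`. -/
def commutators (n : ℕ) : Submodule k (Words k V) :=
  (homogeneous k V n).map (LinearMap.id - rot k V)

theorem sub_rot_mem {n : ℕ} {m : Words k V} (hm : m ∈ homogeneous k V n) :
    m - rot k V m ∈ commutators k V n :=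
  ⟨m, hm, rfl⟩

theorem homotopy_append (l : List (AnyPath V)) (x : AnyPath V) :
    homotopy k V (word k (l ++ [x])) = appM x (homotopy k V (word k l)) +
      (-1 : k) ^ l.length •
        (x.2.2.splittings.map fun s =>
          appM ⟨_, _, s.2.2⟩ (appM ⟨_, _, s.2.1⟩ (word k l))).sum := by
  induction l with
  | nil =>
    rw [List.nil_append, ← consM_word, homotopy_consM, homotopy_nil, split_apply]
    simp
  | cons p l ih =>
    have h : ∀ s ∈ x.2.2.splittings,
        appM ⟨_, _, s.2.2⟩ (appM ⟨_, _, s.2.1⟩ (word k (p :: l))) =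
        consM p (appM ⟨_, _, s.2.2⟩ (appM ⟨_, _, s.2.1⟩ (word k l))) := by
      intro s _; simp
    have h' : split p (word k (l ++ [x])) = appM x (split p (word k l)) := by
      simp only [split_apply, map_list_sum_map, consM_word, appM_word, List.cons_append]
    rw [List.map_congr_left h, ← map_list_sum_map, List.cons_append, ← consM_word, homotopy_consM,
      ih, ← consM_word, homotopy_consM, map_sub, appM_consM, map_add, map_smul, h',
      List.length_cons, pow_succ]
    module

/-- The homotopy descends to the cyclic quotient. Splitting the last letter before or after it is
rotated to the front gives words that differ by two rotations, and splitting any other letter gives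
words that differ by one. -/
theorem homotopy_sub_rot_mem {n : ℕ} {m : Words k V} (hm : m ∈ homogeneous k V n) :
    homotopy k V (m - rot k V m) ∈ commutators k V (n + 1) := by
  suffices h : ∀ l : List (AnyPath V), homotopy k V (word k l - rot k V (word k l)) ∈
      commutators k V (l.length + 1) by
    have hf : ∀ z, (homotopy k V ∘ₗ (LinearMap.id - rot k V)) z = homotopy k V (z - rot k V z) :=
      fun z => by rw [LinearMap.comp_apply, LinearMap.sub_apply, LinearMap.id_apply]
    rw [← hf]
    refine map_mem (fun l hl => ?_) hm
    rw [hf, ← show l.length = n from hl]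
    exact h l
  intro l
  obtain rfl | ⟨l, x, rfl⟩ := l.eq_nil_or_concat'
  · rw [rot_nil, sub_self, map_zero]; exact zero_mem _
  · have hl : word k l ∈ homogeneous k V l.length := word_mem rfl
    set S := (x.2.2.splittings.map fun s =>
      appM ⟨_, _, s.2.2⟩ (appM ⟨_, _, s.2.1⟩ (word k l))).sum with hS
    have hmem : S ∈ homogeneous k V (l.length + 1 + 1) := by
      refine list_sum_mem fun y hy => ?_
      obtain ⟨s, _, rfl⟩ := List.mem_map.1 hy
      exact appM_mem _ (appM_mem _ hl)
    -- Both halves of `x` move to the front; the two rotation signs are equal and cancel.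
    have hrr : rot k V (rot k V S) = split x (word k l) := by
      rw [hS, map_list_sum_map, map_list_sum_map, split_apply]
      congr 1
      refine List.map_congr_left fun s _ => ?_
      rw [rot_appM _ (appM_mem _ hl), map_smul, ← appM_consM, rot_appM _ (consM_mem _ hl),
        smul_smul, ← mul_pow]
      simp
    have key : homotopy k V (word k (l ++ [x]) - rot k V (word k (l ++ [x]))) =
        (appM x (homotopy k V (word k l)) - rot k V (appM x (homotopy k V (word k l)))) +
        (-1 : k) ^ l.length • ((S - rot k V S) + (rot k V S - rot k V (rot k V S))) := by
      rw [map_sub, homotopy_append, ← hS, rot_append, map_smul, ← consM_word, homotopy_consM, hrr,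
        rot_appM _ (homotopy_mem hl), pow_succ]
      module
    rw [key, List.length_append, List.length_singleton]
    refine add_mem (sub_rot_mem (appM_mem _ (homotopy_mem hl))) (Submodule.smul_mem _ _
      (add_mem (sub_rot_mem hmem) (sub_rot_mem (rot_mem hmem))))

/-! ### The weight -/

/-- The total length plus the number of jumps of a word, seen as a way from `a` to `b`. -/
def chainWeight (b : V) : V → List (AnyPath V) → ℕ
  | a, [] => jump a b
  | a, p :: l => jump a p.1 + p.length + chainWeight b p.2.1 l

/-- The total length plus the number of jumps of a word, seen as a cyclic word. -/
def weight : List (AnyPath V) → ℕ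
  | [] => 0
  | p :: l => p.length + chainWeight p.1 p.2.1 l

theorem chainWeight_append (b a : V) (l : List (AnyPath V)) (x : AnyPath V) :
    chainWeight b a (l ++ [x]) =
      chainWeight x.1 a l + x.length + jump x.2.1 b := by
  induction l generalizing a with
  | nil => simp [chainWeight]
  | cons p l ih => simp only [List.cons_append, chainWeight, ih]; ring

theorem weight_append (p : AnyPath V) (l : List (AnyPath V)) (x : AnyPath V) :
    weight (p :: (l ++ [x])) =
      p.length + chainWeight x.1 p.2.1 l + x.length + jump x.2.1 p.1 := by
  rw [weight, chainWeight_append]; ring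

/-- Compared with `weight_append`, the closing jump from the last letter to the first is replaced by
`1`. The discrepancy is one exactly when the word closes up composably. -/
theorem linearWeight_append (p : AnyPath V) (l : List (AnyPath V)) (x : AnyPath V) :
    linearWeight (p :: (l ++ [x])) =
      p.length + chainWeight x.1 p.2.1 l + x.length + 1 := by
  induction l generalizing p with
  | nil => simp only [List.nil_append, linearWeight, chainWeight]; ring
  | cons q l ih => simp only [List.cons_append, linearWeight, ih, chainWeight]; ring

theorem weight_rotateWord (l : List (AnyPath V)) : weight (rotateWord l) = weight l := by
  obtain rfl | ⟨l, x, rfl⟩ := l.eq_nil_or_concat'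
  · rfl
  · rw [rotateWord_append]
    obtain - | ⟨p, l⟩ := l
    · rfl
    · rw [List.cons_append, weight_append, weight, chainWeight]; ring

/-- Words with the same first source and the same weight as any chain. -/
def sameChain (l : List (AnyPath V)) : Set (List (AnyPath V)) :=
  {l' | l'.head?.map Sigma.fst = l.head?.map Sigma.fst ∧
    ∀ a b, chainWeight b a l' = chainWeight b a l}

theorem weight_of_mem_sameChain {l l' : List (AnyPath V)} (h : l' ∈ sameChain l) :
    weight l' = weight l := by
  have key : ∀ (p : AnyPath V) (l : List (AnyPath V)),
      weight (p :: l) = chainWeight p.1 p.1 (p :: l) := by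
    intro p l; simp [weight, chainWeight, jump]
  obtain ⟨h, h'⟩ := h
  obtain - | ⟨p, l⟩ := l <;> obtain - | ⟨p', l'⟩ := l'
  · rfl
  · simp at h
  · simp at h
  · obtain h : p'.1 = p.1 := by simpa using h
    rw [key, key, h', h]

/-- Merging two composable letters adds their lengths and removes a jump equal to zero. Arbitrary
endpoints are carried along because prefixing a letter changes the starting vertex. -/
theorem bar_mem_sameChain (l : List (AnyPath V)) :
    bar k V (word k l) ∈ wordSpan k (sameChain l) := by
  induction l with
  | nil => rw [bar_nil]; exact zero_mem _
  | cons p l ih =>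
    rw [← consM_word, bar_consM]
    refine sub_mem ?_ (map_mem (fun l' hl' => ?_) ih)
    · obtain - | ⟨q, l⟩ := l
      · rw [mulHead_nil]; exact zero_mem _
      · rw [← consM_word, mulHead_consM]
        split_ifs with h
        · rw [consM_word]
          refine word_mem ⟨by simp, fun a b => ?_⟩
          simp only [chainWeight, comp_fst, h.comp_snd, h.length_comp, h.jump_eq_zero]
          ring
        · exact zero_mem _
    · rw [consM_word]
      exact word_mem ⟨by simp, fun a b => by simp only [chainWeight, hl'.2]⟩

/-- Words of a given weight. -/
def ofWeight (n : ℕ) : Set (List (AnyPath V)) := {l | weight l = n}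

theorem hoch_mem_ofWeight (l : List (AnyPath V)) :
    hoch k V (word k l) ∈ wordSpan k (ofWeight (weight l)) := by
  rw [hoch_apply]
  refine add_mem (Submodule.span_mono (Set.image_mono fun _ => weight_of_mem_sameChain)
    (bar_mem_sameChain l)) ?_
  obtain rfl | ⟨l, x, rfl⟩ := l.eq_nil_or_concat'
  · rw [rot_nil, mergeHead_nil]; exact zero_mem _
  · rw [mergeHead_rot_append]
    refine Submodule.smul_mem _ _ ?_
    obtain - | ⟨p, l⟩ := l
    · rw [mulHead_nil]; exact zero_mem _
    · rw [← consM_word, mulHead_consM]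
      split_ifs with h
      · rw [consM_word]
        refine word_mem ?_
        rw [ofWeight, Set.mem_ofPred_eq, List.cons_append, weight_append, h.jump_eq_zero, weight,
          h.comp_snd, h.length_comp, comp_fst]
        ring
      · exact zero_mem _

/-- Scaling each word by a function of its weight. -/
def scale (g : ℕ → k) : Words k V →ₗ[k] Words k V := lift fun l => g (weight l) • word k l

@[simp]
theorem scale_word (g : ℕ → k) (l : List (AnyPath V)) :
    scale g (word k l) = g (weight l) • word k l := by
  rw [scale, lift_word]

/-- The differential preserves the weight, so any rescaling by weight is a chain map. This is what
permits division by the weight. -/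
theorem hoch_scale (g : ℕ → k) (m : Words k V) :
    hoch k V (scale g m) = scale g (hoch k V m) := by
  refine LinearMap.congr_fun (hom_ext (f := hoch k V ∘ₗ scale g) (g := scale g ∘ₗ hoch k V)
    fun l => ?_) m
  simp only [LinearMap.comp_apply, scale_word, map_smul]
  symm
  refine eq_of_mem (f := scale g) (g := g (weight l) • LinearMap.id) (fun l' (hl' : _ = _) => ?_)
    (hoch_mem_ofWeight l)
  rw [scale_word, hl']; rfl

theorem rot_scale (g : ℕ → k) (m : Words k V) : rot k V (scale g m) = scale g (rot k V m) := by
  refine LinearMap.congr_fun (hom_ext (f := rot k V ∘ₗ scale g) (g := scale g ∘ₗ rot k V)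
    fun l => ?_) m
  simp only [LinearMap.comp_apply, rot, lift_word, scale_word, map_smul, weight_rotateWord]
  rw [smul_comm]

theorem scale_mem (g : ℕ → k) {n : ℕ} {m : Words k V} (hm : m ∈ homogeneous k V n) :
    scale g m ∈ homogeneous k V n :=
  map_mem (fun l hl => by rw [scale_word]; exact Submodule.smul_mem _ _ (word_mem hl)) hm

/-- The homotopy formula in the cyclic quotient. -/
theorem hoch_homotopy {n : ℕ} {m : Words k V} (hm : m ∈ homogeneous k V (n + 2)) :
    hoch k V (homotopy k V m) + homotopy k V (hoch k V m) - scale (fun i => (i : k)) m ∈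
      commutators k V (n + 2) := by
  refine map_mem (f := hoch k V ∘ₗ homotopy k V + homotopy k V ∘ₗ hoch k V -
    scale fun i => (i : k)) (fun l (hl : _ = _) => ?_) hm
  simp only [LinearMap.sub_apply, LinearMap.add_apply, LinearMap.comp_apply]
  obtain rfl | ⟨l, x, rfl⟩ := l.eq_nil_or_concat'
  · simp at hl
  obtain - | ⟨p, l⟩ := l
  · simp at hl
  obtain rfl : l.length = n := by simpa using hl
  set w := word k (p :: l ++ [x]) with hw
  have hwl : word k l ∈ homogeneous k V l.length := word_mem rfl
  have hwm : w ∈ homogeneous k V (l.length + 2) := word_mem (by simp)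
  -- The last letter `x` is cut in two: its second half is multiplied onto the first letter of the
  -- word, across the cyclic seam, and its first half stays at the end.
  set S := (x.2.2.splittings.map fun s =>
    appM ⟨_, _, s.2.1⟩ (mulHead ⟨_, _, s.2.2⟩ (consM p (word k l)))).sum with hS
  have hmem : S ∈ homogeneous k V (l.length + 2) := by
    refine list_sum_mem fun y hy => ?_
    obtain ⟨s, _, rfl⟩ := List.mem_map.1 hy
    exact appM_mem _ (mulHead_mem _ (consM_mem _ hwl))
  have hrot : rot k V S = (-1 : k) ^ (l.length + 1) • splitMul x (consM p (word k l)) := by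
    rw [hS, map_list_sum_map, splitMul, ← LinearMap.lsmul_apply, map_list_sum_map]
    congr 1
    refine List.map_congr_left fun s _ => ?_
    rw [rot_appM _ (mulHead_mem _ (consM_mem _ hwl)), LinearMap.lsmul_apply]
  -- The splittings of `x` enter the homotopy and the last face with opposite signs, whence `-S`.
  have h1 : mergeHead k V (rot k V (homotopy k V w)) =
      (-1 : k) ^ l.length • mulHead x (homotopy k V (consM p (word k l))) - S := by
    rw [hw, homotopy_append, map_add, map_add,
      mergeHead_rot_appM _ (homotopy_mem (word_mem rfl)), map_smul, map_smul, map_list_sum_map,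
      map_list_sum_map]
    have : ∀ s ∈ x.2.2.splittings, mergeHead k V (rot k V
        (appM ⟨_, _, s.2.2⟩ (appM ⟨_, _, s.2.1⟩ (word k (p :: l))))) =
        LinearMap.lsmul k _ ((-1 : k) ^ (l.length + 2))
          (appM ⟨_, _, s.2.1⟩ (mulHead ⟨_, _, s.2.2⟩ (consM p (word k l)))) := by
      intro s _
      rw [mergeHead_rot_appM _ (appM_mem _ (word_mem rfl)), appM_word, mulHead_append (by simp),
        consM_word, List.length_cons, LinearMap.lsmul_apply]
    rw [List.map_congr_left this, ← map_list_sum_map, ← hS, consM_word, List.length_cons,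
      LinearMap.lsmul_apply, smul_smul]
    obtain h | h := neg_one_pow_eq_or k l.length <;> simp only [pow_succ, h] <;> module
  have h2 : homotopy k V (mergeHead k V (rot k V w)) =
      (-1 : k) ^ (l.length + 1) • homotopy k V (mulHead x (consM p (word k l))) := by
    rw [hw, mergeHead_rot_append, map_smul, consM_word, List.length_cons]
  have h3 : rot k V w = (-1 : k) ^ (l.length + 1) • consM x (consM p (word k l)) := by
    rw [hw, rot_append, consM_word, consM_word, List.length_cons]
  have h4 := mulHead_split x p (word k l)
  have h5 := bar_homotopy (k := k) (p :: l ++ [x])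
  rw [List.cons_append, linearWeight_append, ← List.cons_append, ← hw] at h5
  classical
  -- `bar_homotopy` gives the linear weight. If `x` composes with `p`, this exceeds the cyclic
  -- weight by one, and the excess `w` pairs with the surplus word of `mulHead_split`, which is `rot
  -- w` up to sign. The terms across the seam form `S - rot S`.
  have key : hoch k V (homotopy k V w) + homotopy k V (hoch k V w) - scale (fun i => (i : k)) w =
      (if x.Composable p then w - rot k V w else 0) - (S - rot k V S) := by
    rw [hoch_apply, hoch_apply, map_add, h1, h2]
    rw [← eq_sub_iff_add_eq] at h4 h5
    rw [h5, hrot, h3, h4, homotopy_consM, map_sub, mulHead_consM, mulHead_consM, hw, scale_word,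
      ← hw, List.cons_append, weight_append,
      show jump x.2.1 p.1 = if x.Composable p then 0 else 1 from rfl]
    obtain h | h := neg_one_pow_eq_or k l.length <;> split_ifs <;>
      simp only [pow_succ, h, homotopy_consM, map_zero] <;> push_cast <;> module
  rw [key]
  refine sub_mem ?_ (sub_rot_mem hmem)
  split_ifs
  · exact sub_rot_mem hwm
  · exact zero_mem _

/-! ### Words of weight zero -/

/-- The path of length zero at a vertex. -/
def idPath (a : V) : AnyPath V := ⟨a, a, .nil⟩

/-- Length zero makes every letter a vertex, and the absence of jumps makes all these vertices
equal. -/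
theorem eq_replicate_of_chainWeight_eq_zero {a b : V} {l : List (AnyPath V)}
    (h : chainWeight b a l = 0) : a = b ∧ l = List.replicate l.length (idPath a) := by
  have jump_eq : ∀ {a b : V}, jump a b = 0 → a = b := by
    intro a b h; by_contra hab; simp [jump, hab] at h
  induction l generalizing a with
  | nil => exact ⟨jump_eq h, rfl⟩
  | cons p l ih =>
    obtain ⟨c, d, p⟩ := p
    simp only [chainWeight, Nat.add_eq_zero_iff] at h
    obtain ⟨⟨h1, h2⟩, h3⟩ := h
    obtain rfl : a = c := jump_eq h1
    cases p with
    | nil =>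
      obtain ⟨h4, h5⟩ := ih h3
      exact ⟨h4, by rw [List.length_cons, List.replicate_succ, ← h5]; rfl⟩
    | cons p e => simp [length] at h2

theorem eq_replicate_of_weight_eq_zero {l : List (AnyPath V)} (hl : l ≠ []) (h : weight l = 0) :
    ∃ a, l = List.replicate l.length (idPath a) := by
  obtain ⟨⟨a, b, p⟩, l, rfl⟩ := List.exists_cons_of_ne_nil hl
  simp only [weight, Nat.add_eq_zero_iff] at h
  obtain ⟨h1, h2⟩ := h
  cases p with
  | nil =>
    obtain ⟨_, h5⟩ := eq_replicate_of_chainWeight_eq_zero h2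
    exact ⟨a, by rw [List.length_cons, List.replicate_succ, ← h5]; rfl⟩
  | cons p e => simp [length] at h1

theorem weight_replicate (n : ℕ) (a : V) : weight (List.replicate n (idPath a)) = 0 := by
  have : ∀ n, chainWeight a a (List.replicate n (idPath a)) = 0 := by
    intro n
    induction n with
    | zero => simp [chainWeight, jump]
    | succ n ih => simpa [List.replicate_succ, chainWeight, jump, idPath, length] using ih
  cases n with
  | zero => rfl
  | succ n => simpa [List.replicate_succ, weight, idPath, length] using this n

theorem rot_replicate (n : ℕ) (a : V) :
    rot k V (word k (List.replicate (n + 1) (idPath a))) =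
      (-1 : k) ^ n • word k (List.replicate (n + 1) (idPath a)) := by
  rw [List.replicate_succ', rot_append, ← List.replicate_succ', List.replicate_succ,
    List.length_replicate]

theorem mulHead_replicate (n : ℕ) (a : V) :
    mulHead (idPath a) (word k (List.replicate (n + 1) (idPath a))) =
      word k (List.replicate (n + 1) (idPath a)) := by
  rw [List.replicate_succ, ← consM_word, mulHead_consM_of rfl]
  congr 2
  exact comp_mk .nil .nil

/-- All `n` faces of the constant word agree, so their alternating sum is `0` or `1` times the
shorter word. In `hoch_replicate` there is one face more. -/
theorem bar_replicate (n : ℕ) (a : V) :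
    bar k V (word k (List.replicate (n + 1) (idPath a))) =
      (if Even n then (0 : k) else 1) • word k (List.replicate n (idPath a)) := by
  induction n with
  | zero => simp [bar_singleton]
  | succ n ih =>
    rw [List.replicate_succ, ← consM_word, bar_consM, ih, mulHead_replicate, map_smul, consM_word,
      ← List.replicate_succ]
    by_cases h : Even n <;> simp [h, Nat.even_add_one]

theorem hoch_replicate (n : ℕ) (a : V) :
    hoch k V (word k (List.replicate (n + 2) (idPath a))) =
      (if Even n then (0 : k) else 1) • word k (List.replicate (n + 1) (idPath a)) := by
  rw [hoch_apply, bar_replicate, List.replicate_succ' (n := n + 1), mergeHead_rot_append,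
    mulHead_replicate, List.length_replicate, pow_succ]
  by_cases h : Even n
  · simp [h, Nat.even_add_one, h.neg_one_pow]
  · simp [h, Nat.even_add_one, (Nat.not_even_iff_odd.1 h).neg_one_pow]

open Classical in
variable (k V) in
/-- The coefficients of a combination of words at the words of weight zero. -/
def vertexPart : Words k V →ₗ[k] V →₀ k :=
  lift fun
    | [] => 0
    | p :: l => if weight (p :: l) = 0 then Finsupp.single p.1 1 else 0

theorem vertexPart_replicate (n : ℕ) (a : V) :
    vertexPart k V (word k (List.replicate (n + 1) (idPath a))) = Finsupp.single a 1 := by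
  have := weight_replicate (n + 1) a
  rw [List.replicate_succ] at this ⊢
  simp only [vertexPart, lift_word]
  rw [if_pos this]
  rfl

theorem vertexPart_of_weight_ne_zero {l : List (AnyPath V)} (h : weight l ≠ 0) :
    vertexPart k V (word k l) = 0 := by
  cases l with
  | nil => simp [vertexPart]
  | cons p l => simp only [vertexPart, lift_word]; rw [if_neg h]

/-- The faces of a constant word of even length cancel in pairs, and a word of nonzero weight has no
component of weight zero in its boundary. -/
theorem vertexPart_hoch {n : ℕ} (hn : Even n) {m : Words k V}
    (hm : m ∈ homogeneous k V (n + 2)) : vertexPart k V (hoch k V m) = 0 := by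
  refine eq_of_mem (f := vertexPart k V ∘ₗ hoch k V) (g := 0) (fun l (hl : _ = _) => ?_) hm
  rw [LinearMap.comp_apply, LinearMap.zero_apply]
  by_cases h : weight l = 0
  · obtain ⟨a, ha⟩ := eq_replicate_of_weight_eq_zero
      (List.ne_nil_of_length_eq_add_one (n := n + 1) hl) h
    rw [ha, hl, hoch_replicate, if_pos hn, zero_smul, map_zero]
  · refine eq_of_mem (g := 0) (fun l' (hl' : _ = _) => ?_) (hoch_mem_ofWeight l)
    rw [vertexPart_of_weight_ne_zero (hl' ▸ h), LinearMap.zero_apply]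

theorem vertexPart_rot {n : ℕ} (hn : Even n) {m : Words k V}
    (hm : m ∈ homogeneous k V (n + 1)) : vertexPart k V (rot k V m) = vertexPart k V m := by
  refine eq_of_mem (f := vertexPart k V ∘ₗ rot k V) (fun l (hl : _ = _) => ?_) hm
  rw [LinearMap.comp_apply]
  by_cases h : weight l = 0
  · obtain ⟨a, ha⟩ := eq_replicate_of_weight_eq_zero
      (List.ne_nil_of_length_eq_add_one (n := n) hl) h
    rw [ha, hl, rot_replicate, hn.neg_one_pow, one_smul]
  · rw [vertexPart_of_weight_ne_zero h, rot, lift_word, map_smul,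
      vertexPart_of_weight_ne_zero ((weight_rotateWord l).symm ▸ h), smul_zero]

/-- The projection onto the words of weight zero. -/
def weightZero : Words k V →ₗ[k] Words k V := scale fun i => if i = 0 then 1 else 0

theorem weightZero_eq {n : ℕ} {m : Words k V} (hm : m ∈ homogeneous k V (n + 1)) :
    weightZero m = Finsupp.linearCombination k
      (fun a => word k (List.replicate (n + 1) (idPath a))) (vertexPart k V m) := by
  refine eq_of_mem (g := Finsupp.linearCombination k
      (fun a => word k (List.replicate (n + 1) (idPath a))) ∘ₗ vertexPart k V)
      (fun l (hl : _ = _) => ?_) hm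
  rw [LinearMap.comp_apply, weightZero, scale_word]
  by_cases h : weight l = 0
  · obtain ⟨a, ha⟩ := eq_replicate_of_weight_eq_zero
      (List.ne_nil_of_length_eq_add_one (n := n) hl) h
    rw [if_pos h, ha, hl, vertexPart_replicate]
    simp
  · rw [if_neg h, vertexPart_of_weight_ne_zero h, map_zero, zero_smul]

/-! ### Faces -/

variable (k V) in
/-- The product of the letters `i` and `i + 1`. -/
def faceM : ℕ → Words k V →ₗ[k] Words k V
  | 0 => mergeHead k V
  | i + 1 => lift fun
    | [] => 0
    | p :: l => consM p (faceM i (word k l))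

theorem faceM_succ_consM (i : ℕ) (p : AnyPath V) (m : Words k V) :
    faceM k V (i + 1) (consM p m) = consM p (faceM k V i m) :=
  LinearMap.congr_fun (hom_ext (f := faceM k V (i + 1) ∘ₗ consM p) (g := consM p ∘ₗ faceM k V i)
    fun l => by simp only [LinearMap.comp_apply, consM_word, faceM, lift_word]) m

/-- Links the recursive differential with the alternating sum of faces that defines
`barDifferential`. -/
theorem bar_eq_sum {n : ℕ} {m : Words k V} (hm : m ∈ homogeneous k V (n + 1)) :
    bar k V m = ∑ i ∈ Finset.range n, (-1 : k) ^ i • faceM k V i m := by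
  have key : ∀ l : List (AnyPath V), ∀ n, l.length = n + 1 → bar k V (word k l) =
      ∑ i ∈ Finset.range n, (-1 : k) ^ i • faceM k V i (word k l) := by
    intro l
    induction l with
    | nil => simp
    | cons p l ih =>
      intro n hn
      obtain - | n := n
      · rw [List.length_eq_zero_iff.1 (by simpa using hn : l.length = 0), bar_singleton]; simp
      · rw [Finset.sum_range_succ', ← consM_word, bar_consM, ih n (by simpa using hn)]
        simp only [faceM_succ_consM, pow_succ, map_sum, map_smul, mul_smul, neg_one_smul, smul_neg,
          Finset.sum_neg_distrib, pow_zero, one_smul]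
        rw [faceM, mergeHead_consM]
        abel
  have := eq_of_mem (f := bar k V) (g := ∑ i ∈ Finset.range n, (-1 : k) ^ i • faceM k V i)
    (fun l hl => by simpa using key l n hl) hm
  simpa using this

theorem faceM_append {i : ℕ} {l : List (AnyPath V)} (h : i + 2 ≤ l.length) (x : AnyPath V) :
    faceM k V i (word k (l ++ [x])) = appM x (faceM k V i (word k l)) := by
  induction i generalizing l with
  | zero =>
    obtain - | ⟨p, l⟩ := l
    · simp at h
    · rw [List.cons_append, ← consM_word, ← consM_word, faceM, mergeHead_consM, mergeHead_consM,
        mulHead_append]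
      rintro rfl
      simp at h
  | succ i ih =>
    obtain - | ⟨p, l⟩ := l
    · simp at h
    · rw [List.cons_append, ← consM_word, ← consM_word, faceM_succ_consM, faceM_succ_consM,
        ih (by simpa using h), appM_consM]

theorem faceM_mem (i : ℕ) {n : ℕ} {m : Words k V} (hm : m ∈ homogeneous k V (n + 1)) :
    faceM k V i m ∈ homogeneous k V n := by
  induction i generalizing n m with
  | zero =>
    refine map_mem (fun l (hl : _ = _) => ?_) hm
    obtain - | ⟨p, l⟩ := l
    · simp at hl
    · rw [← consM_word, faceM, mergeHead_consM]
      exact mulHead_mem _ (word_mem (by simpa using hl))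
  | succ i ih =>
    refine map_mem (fun l (hl : _ = _) => ?_) hm
    obtain - | ⟨p, l⟩ := l
    · simp at hl
    · rw [← consM_word, faceM_succ_consM]
      obtain - | n := n
      · obtain rfl : l = [] := by simpa using hl
        cases i
        · rw [faceM, mergeHead_nil, map_zero]; exact zero_mem _
        · rw [faceM, lift_word, map_zero]; exact zero_mem _
      · exact consM_mem p (ih (word_mem (by simpa using hl)))

/-- The presimplicial relation `dᵢ₊₁ t = -t dᵢ`, valid while the face does not involve the rotated
letter. It is used for the relation between `N`, `b` and `b'`. -/
theorem faceM_rot {i n : ℕ} (h : i + 2 ≤ n) {m : Words k V} (hm : m ∈ homogeneous k V (n + 1)) :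
    faceM k V (i + 1) (rot k V m) = -rot k V (faceM k V i m) := by
  refine eq_of_mem (f := faceM k V (i + 1) ∘ₗ rot k V) (g := -(rot k V ∘ₗ faceM k V i))
    (fun l (hl : _ = _) => ?_) hm
  simp only [LinearMap.neg_apply, LinearMap.comp_apply]
  obtain rfl | ⟨l, x, rfl⟩ := l.eq_nil_or_concat'
  · simp at hl
  obtain ⟨n, rfl⟩ : ∃ n', n = n' + 1 := ⟨n - 1, by omega⟩
  have hl' : l.length = n + 1 := by simpa using hl
  rw [faceM_append (by omega), rot_append, rot_appM x (faceM_mem i (word_mem hl')), map_smul,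
    ← consM_word, faceM_succ_consM, hl', pow_succ]
  module

open Classical in
theorem faceM_ofFn {q : ℕ} (f : Fin (q + 2) → AnyPath V) (i : Fin (q + 1)) :
    faceM k V i (word k (List.ofFn f)) =
      if (f i.castSucc).Composable (f i.succ) then
        word k (List.ofFn (Fin.contractNth i.castSucc comp f)) else 0 := by
  induction q with
  | zero =>
    obtain rfl : i = 0 := Fin.fin_one_eq_zero i
    rw [List.ofFn_succ, ← consM_word, Fin.val_zero, faceM, mergeHead_consM, List.ofFn_succ,
      ← consM_word, mulHead_consM]
    congr 1
    rw [List.ofFn_succ, List.ofFn_zero, consM_word]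
    simp [Fin.contractNth]
  | succ q ih =>
    cases i using Fin.cases with
    | zero =>
      rw [List.ofFn_succ, ← consM_word, Fin.val_zero, faceM, mergeHead_consM, List.ofFn_succ,
        ← consM_word, mulHead_consM]
      congr 1
      rw [consM_word, List.ofFn_succ (f := Fin.contractNth _ _ _)]
      simp [Fin.contractNth]
    | succ i =>
      rw [List.ofFn_succ, ← consM_word, Fin.val_succ, faceM_succ_consM, ih, apply_ite (consM _),
        map_zero, consM_word, List.ofFn_succ (f := Fin.contractNth i.succ.castSucc _ _)]
      have h0 : Fin.contractNth i.succ.castSucc comp f 0 = f 0 := by simp [Fin.contractNth]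
      have hs : (fun j : Fin (q + 1) => Fin.contractNth i.succ.castSucc comp f j.succ) =
          Fin.contractNth i.castSucc comp fun j => f j.succ := by
        funext j
        simp only [Fin.contractNth, Fin.val_succ, Fin.val_castSucc, Nat.add_lt_add_iff_right,
          Nat.add_right_cancel_iff, Fin.succ_castSucc]
      rw [h0, hs, Fin.succ_castSucc]

/-! ### Division by the weight in the cyclic quotient -/

variable [Algebra ℚ k]

/-- In odd degree `t = -1` on constant words, so `1 - t` acts on them as the invertible scalar `2`.
-/
theorem weightZero_mem_of_odd {n : ℕ} (hn : Odd n) {m : Words k V}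
    (hm : m ∈ homogeneous k V (n + 1)) : weightZero m ∈ commutators k V (n + 1) := by
  refine map_mem (fun l (hl : l.length = n + 1) => ?_) hm
  rw [weightZero, scale_word]
  by_cases h : weight l = 0
  · obtain ⟨a, ha⟩ := eq_replicate_of_weight_eq_zero
      (List.ne_nil_of_length_eq_add_one (n := n) hl) h
    have h2 : algebraMap ℚ k 2⁻¹ * 2 = 1 := by
      rw [← map_ofNat (algebraMap ℚ k) 2, ← map_mul]; norm_num
    have hr : word k l - rot k V (word k l) = (2 : k) • word k l := by
      rw [ha, hl, rot_replicate, hn.neg_one_pow]; module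
    have := Submodule.smul_mem _ (algebraMap ℚ k 2⁻¹)
      (sub_rot_mem (word_mem_homogeneous (k := k) hl))
    rw [hr, smul_smul, h2] at this
    rwa [if_pos h]
  · rw [if_neg h, zero_smul]; exact zero_mem _

/-- A word of length at least two whose Hochschild boundary vanishes in the cyclic quotient is a
boundary in the cyclic quotient, up to words of weight zero. -/
theorem exists_hoch_of_hoch_mem {n : ℕ} {z : Words k V} (hz : z ∈ homogeneous k V (n + 2))
    (hb : hoch k V z ∈ commutators k V (n + 1)) (h0 : weightZero z ∈ commutators k V (n + 2)) :
    ∃ y ∈ homogeneous k V (n + 3), z - hoch k V y ∈ commutators k V (n + 2) := by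
  -- The inverse weight. The convention `0⁻¹ = 0` discards weight zero, which `h1` restores through
  -- `weightZero`.
  set g : ℕ → k := fun i => algebraMap ℚ k (i : ℚ)⁻¹ with hg
  have hz' := scale_mem g hz
  refine ⟨homotopy k V (scale g z), homotopy_mem hz', ?_⟩
  have h1 : z = scale (fun i => (i : k)) (scale g z) + weightZero z := by
    refine LinearMap.congr_fun (hom_ext (f := LinearMap.id)
      (g := scale (fun i => (i : k)) ∘ₗ scale g + weightZero) fun l => ?_) z
    simp only [LinearMap.id_apply, LinearMap.add_apply, LinearMap.comp_apply, weightZero,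
      scale_word, map_smul, smul_smul, ← add_smul]
    have : g (weight l) * (weight l : k) + (if weight l = 0 then 1 else 0) = 1 := by
      rw [hg]
      by_cases h : weight l = 0
      · simp [h]
      · have h' : (weight l : ℚ) ≠ 0 := by exact_mod_cast h
        rw [if_neg h, add_zero, ← map_natCast (algebraMap ℚ k), ← map_mul, inv_mul_cancel₀ h',
          map_one]
    rw [this, one_smul]
  -- Scaling commutes with `b` and `t`, so the boundary of the rescaled chain is still zero in the
  -- cyclic quotient, and the homotopy respects this quotient.
  have h2 : homotopy k V (hoch k V (scale g z)) ∈ commutators k V (n + 2) := by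
    obtain ⟨v, hv, hv'⟩ := hb
    rw [hoch_scale, ← hv', LinearMap.sub_apply, LinearMap.id_apply, map_sub, ← rot_scale]
    exact homotopy_sub_rot_mem (scale_mem g hv)
  have h3 := hoch_homotopy hz'
  have : z - hoch k V (homotopy k V (scale g z)) = weightZero z +
      homotopy k V (hoch k V (scale g z)) - (hoch k V (homotopy k V (scale g z)) +
      homotopy k V (hoch k V (scale g z)) - scale (fun i => (i : k)) (scale g z)) := by
    nth_rewrite 1 [h1]
    abel
  rw [this]
  exact sub_mem (add_mem h0 h2) h3

end Words

end PathAlgebra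

namespace PathAlgebra

open AnyPath Words CyclicHomology

/-! ### Algebras with a basis of paths -/

variable {k : Type w} [CommRing k] {V : Type u} [Quiver.{v} V] {A : Type*} [NonUnitalRing A]
  [Module k A]

/-- A basis of an algebra indexed by the paths of a quiver which multiplies as paths do. -/
structure IsPathBasis (β : Module.Basis (AnyPath V) k A) : Prop where
  mul_of_composable : ∀ p q : AnyPath V, p.Composable q → β p * β q = β (comp p q)
  mul_of_not_composable : ∀ p q : AnyPath V, ¬ p.Composable q → β p * β q = 0

/-- The basis of a tensor power given by a basis of paths. -/
def tensorBasis (β : Module.Basis (AnyPath V) k A) (n : ℕ) :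
    Module.Basis (Fin (n + 1) → AnyPath V) k (⨂[k]^(n + 1) A) :=
  Basis.piTensorProduct fun _ => β

theorem tensorBasis_apply (β : Module.Basis (AnyPath V) k A) {n : ℕ}
    (f : Fin (n + 1) → AnyPath V) :
    tensorBasis β n f = PiTensorProduct.tprod k fun i => β (f i) :=
  Basis.piTensorProduct_apply _ _

/-- Elements of tensor powers as combinations of words. -/
def toWords (β : Module.Basis (AnyPath V) k A) (n : ℕ) : (⨂[k]^(n + 1) A) →ₗ[k] Words k V :=
  Finsupp.lmapDomain k k List.ofFn ∘ₗ (tensorBasis β n).repr.toLinearMap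

theorem toWords_tensorBasis (β : Module.Basis (AnyPath V) k A) {n : ℕ}
    (f : Fin (n + 1) → AnyPath V) : toWords β n (tensorBasis β n f) = word k (List.ofFn f) := by
  simp [toWords]

/-- By injectivity, identities between operators on tensor powers may be checked on words. -/
theorem toWords_injective (β : Module.Basis (AnyPath V) k A) (n : ℕ) :
    Function.Injective (toWords β n) :=
  (Finsupp.mapDomain_injective List.ofFn_injective).comp (tensorBasis β n).repr.injective

theorem exists_toWords_eq (β : Module.Basis (AnyPath V) k A) {n : ℕ} {z : Words k V}
    (hz : z ∈ homogeneous k V (n + 1)) : ∃ x, toWords β n x = z := by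
  refine map_mem (f := LinearMap.id) (S := LinearMap.range (toWords β n))
    (fun l (hl : l.length = n + 1) => ?_) hz
  refine ⟨tensorBasis β n fun i => l.get (i.cast hl.symm), ?_⟩
  rw [toWords_tensorBasis, LinearMap.id_apply]
  congr 1
  exact (List.ofFn_congr hl _).symm.trans (List.ofFn_get l)

theorem toWords_mem (β : Module.Basis (AnyPath V) k A) {n : ℕ} (x : ⨂[k]^(n + 1) A) :
    toWords β n x ∈ homogeneous k V (n + 1) := by
  have h : (homogeneous k V (n + 1)).mkQ ∘ₗ toWords β n = 0 := (tensorBasis β n).ext fun f => by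
    rw [LinearMap.comp_apply, toWords_tensorBasis, LinearMap.zero_apply, Submodule.mkQ_apply,
      Submodule.Quotient.mk_eq_zero]
    exact word_mem List.length_ofFn
  exact (Submodule.Quotient.mk_eq_zero _).1 (LinearMap.congr_fun h x)

theorem ofFn_rotate {P : Type*} {n : ℕ} (f : Fin (n + 1) → P) :
    List.ofFn (fun i => f ((finRotate (n + 1)).symm i)) =
      f (Fin.last n) :: List.ofFn fun i : Fin n => f i.castSucc := by
  have h : (fun i => f ((finRotate (n + 1)).symm i)) =
      Fin.cons (α := fun _ => P) (f (Fin.last n)) fun i : Fin n => f i.castSucc := by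
    have := Fin.snoc_eq_cons_rotate (fun i : Fin n => f i.castSucc) (f (Fin.last n))
    funext i
    have h' := congrFun this ((finRotate (n + 1)).symm i)
    rw [Equiv.apply_symm_apply] at h'
    rw [← h']
    exact (congrFun (Fin.snoc_init_self (α := fun _ => P) f) _).symm
  rw [h, List.ofFn_cons]

theorem contractNth_comp {β : Module.Basis (AnyPath V) k A} (hβ : IsPathBasis β) {q : ℕ}
    (f : Fin (q + 2) → AnyPath V) (i : Fin (q + 1))
    (h : (f i.castSucc).Composable (f i.succ)) :
    Fin.contractNth i.castSucc (· * ·) (fun j => β (f j)) =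
      fun j => β (Fin.contractNth i.castSucc comp f j) := by
  funext j
  rcases lt_trichotomy (j : ℕ) (i.castSucc : ℕ) with h' | h' | h'
  · rw [Fin.contractNth_apply_of_lt _ _ _ _ h', Fin.contractNth_apply_of_lt _ _ _ _ h']
  · obtain rfl : j = i := Fin.ext h'
    rw [Fin.contractNth_apply_of_eq _ _ _ _ h', Fin.contractNth_apply_of_eq _ _ _ _ h',
      hβ.mul_of_composable _ _ h]
  · rw [Fin.contractNth_apply_of_gt _ _ _ _ h', Fin.contractNth_apply_of_gt _ _ _ _ h']

theorem rotation_tensorBasis (β : Module.Basis (AnyPath V) k A) {n : ℕ}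
    (f : Fin (n + 1) → AnyPath V) :
    rotation k A n (tensorBasis β n f) =
      tensorBasis β n fun i => f ((finRotate (n + 1)).symm i) := by
  rw [tensorBasis_apply, tensorBasis_apply]
  exact PiTensorProduct.reindex_tprod _ _

theorem toWords_cyclicOperator (β : Module.Basis (AnyPath V) k A) {n : ℕ} (x : ⨂[k]^(n + 1) A) :
    toWords β n (cyclicOperator k A n x) = rot k V (toWords β n x) := by
  refine LinearMap.congr_fun ((tensorBasis β n).ext
    (f₁ := toWords β n ∘ₗ cyclicOperator k A n) (f₂ := rot k V ∘ₗ toWords β n) fun f => ?_) x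
  rw [LinearMap.comp_apply, LinearMap.comp_apply, cyclicOperator, LinearMap.smul_apply,
    rotation_tensorBasis, map_smul, toWords_tensorBasis, toWords_tensorBasis, ofFn_rotate,
    List.ofFn_succ', List.concat_eq_append, rot_append, List.length_ofFn]

theorem finRotate_symm_pow (n j : ℕ) (i : Fin (n + 1)) :
    ((finRotate (n + 1)).symm ^ j) i = i - j • (1 : Fin (n + 1)) := by
  induction j with
  | zero => simp
  | succ j ih => rw [pow_succ', Equiv.Perm.mul_apply, ih, finRotate_symm_apply, succ_nsmul]; abel

theorem cyclicOperator_pow (β : Module.Basis (AnyPath V) k A) (n : ℕ) :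
    cyclicOperator k A n ^ (n + 1) = 1 := by
  have h : ∀ j (f : Fin (n + 1) → AnyPath V), (cyclicOperator k A n ^ j) (tensorBasis β n f) =
      ((-1 : k) ^ n) ^ j •
        tensorBasis β n fun i => f (((finRotate (n + 1)).symm ^ j) i) := by
    intro j f
    induction j with
    | zero => simp
    | succ j ih =>
      rw [pow_succ', Module.End.mul_apply, ih, map_smul, cyclicOperator, LinearMap.smul_apply,
        rotation_tensorBasis, smul_smul, ← pow_succ]
      simp only [pow_succ, Equiv.Perm.mul_apply]
  refine (tensorBasis β n).ext fun f => ?_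
  -- The accumulated sign is `(-1)^(n (n + 1)) = 1`.
  rw [h, ← pow_mul, (Nat.even_mul_succ_self n).neg_one_pow, one_smul]
  have hc : (n + 1) • (1 : Fin (n + 1)) = 0 := by
    simpa using card_nsmul_eq_zero (x := (1 : Fin (n + 1)))
  simp only [finRotate_symm_pow, hc, sub_zero, Module.End.one_apply]

theorem sub_mem_range_of_commutators (β : Module.Basis (AnyPath V) k A) {n : ℕ}
    {x : ⨂[k]^(n + 1) A} (h : toWords β n x ∈ commutators k V (n + 1)) :
    x ∈ LinearMap.range (LinearMap.id - cyclicOperator k A n) := by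
  obtain ⟨u, hu, hux⟩ := h
  obtain ⟨v, rfl⟩ := exists_toWords_eq β hu
  refine ⟨v, toWords_injective β n ?_⟩
  rw [← hux, LinearMap.sub_apply, LinearMap.sub_apply, map_sub, toWords_cyclicOperator,
    LinearMap.id_apply, LinearMap.id_apply]

theorem toWords_mem_commutators (β : Module.Basis (AnyPath V) k A) {n : ℕ}
    {x : ⨂[k]^(n + 1) A} (h : x ∈ LinearMap.range (LinearMap.id - cyclicOperator k A n)) :
    toWords β n x ∈ commutators k V (n + 1) := by
  obtain ⟨v, rfl⟩ := h
  rw [LinearMap.sub_apply, LinearMap.id_apply, map_sub, toWords_cyclicOperator]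
  exact sub_rot_mem (toWords_mem β v)

variable [IsScalarTower k A A] [SMulCommClass k A A]

theorem toWords_face {β : Module.Basis (AnyPath V) k A} (hβ : IsPathBasis β) {q : ℕ}
    (i : Fin (q + 1)) (x : ⨂[k]^(q + 2) A) :
    toWords β q (face k A q i x) = faceM k V i (toWords β (q + 1) x) := by
  refine LinearMap.congr_fun ((tensorBasis β (q + 1)).ext
    (f₁ := toWords β q ∘ₗ face k A q i) (f₂ := faceM k V i ∘ₗ toWords β (q + 1)) fun f => ?_) x
  have hface : face k A q i (tensorBasis β (q + 1) f) =
      PiTensorProduct.tprod k (Fin.contractNth i.castSucc (· * ·) fun j => β (f j)) := by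
    rw [tensorBasis_apply]
    exact PiTensorProduct.lift.tprod _
  rw [LinearMap.comp_apply, LinearMap.comp_apply, toWords_tensorBasis, faceM_ofFn, hface]
  split_ifs with h
  · rw [contractNth_comp hβ f i h, ← tensorBasis_apply, toWords_tensorBasis]
  -- The merged entry is a product of non-composable paths, hence zero.
  · rw [MultilinearMap.map_coord_zero _ i, map_zero]
    rw [Fin.contractNth_apply_of_eq _ _ _ _ (by simp)]
    exact hβ.mul_of_not_composable _ _ h

theorem toWords_barDifferential {β : Module.Basis (AnyPath V) k A} (hβ : IsPathBasis β) {q : ℕ}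
    (x : ⨂[k]^(q + 2) A) :
    toWords β q (barDifferential k A q x) = bar k V (toWords β (q + 1) x) := by
  rw [bar_eq_sum (toWords_mem β x), barDifferential, LinearMap.sum_apply, map_sum,
    Finset.sum_range]
  simp only [LinearMap.smul_apply, map_smul, toWords_face hβ]

theorem toWords_hochschildDifferential {β : Module.Basis (AnyPath V) k A} (hβ : IsPathBasis β)
    {q : ℕ} (x : ⨂[k]^(q + 2) A) :
    toWords β q (hochschildDifferential k A q x) = hoch k V (toWords β (q + 1) x) := by
  rw [hochschildDifferential, LinearMap.add_apply, map_add, toWords_barDifferential hβ,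
    hoch_apply, ← toWords_cyclicOperator, LinearMap.smul_apply, LinearMap.comp_apply, map_smul,
    toWords_face hβ, cyclicOperator, LinearMap.smul_apply, map_smul, map_smul, Fin.val_zero, faceM]

/-! ### Identities between the operators -/

theorem barDifferential_barDifferential {β : Module.Basis (AnyPath V) k A} (hβ : IsPathBasis β)
    (q : ℕ) (x : ⨂[k]^(q + 3) A) :
    barDifferential k A q (barDifferential k A (q + 1) x) = 0 :=
  toWords_injective β q (by
    rw [toWords_barDifferential hβ, toWords_barDifferential hβ, bar_bar, map_zero])

theorem hochschildDifferential_hochschildDifferential {β : Module.Basis (AnyPath V) k A}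
    (hβ : IsPathBasis β) (q : ℕ) (x : ⨂[k]^(q + 3) A) :
    hochschildDifferential k A q (hochschildDifferential k A (q + 1) x) = 0 :=
  toWords_injective β q (by
    rw [toWords_hochschildDifferential hβ, toWords_hochschildDifferential hβ, hoch_hoch, map_zero])

theorem hochschildDifferential_sub {β : Module.Basis (AnyPath V) k A} (hβ : IsPathBasis β) (q : ℕ)
    (x : ⨂[k]^(q + 2) A) :
    hochschildDifferential k A q (x - cyclicOperator k A (q + 1) x) =
      barDifferential k A q x - cyclicOperator k A q (barDifferential k A q x) :=
  toWords_injective β q (by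
    rw [toWords_hochschildDifferential hβ, map_sub, map_sub, map_sub, toWords_cyclicOperator,
      toWords_cyclicOperator, toWords_barDifferential hβ, hoch_rot, hoch_apply]
    abel)

theorem face_cyclicOperator {β : Module.Basis (AnyPath V) k A} (hβ : IsPathBasis β) {q : ℕ}
    (i : Fin q) (x : ⨂[k]^(q + 2) A) :
    face k A q i.succ (cyclicOperator k A (q + 1) x) =
      -cyclicOperator k A q (face k A q i.castSucc x) :=
  toWords_injective β q (by
    rw [toWords_face hβ, map_neg, toWords_cyclicOperator, toWords_cyclicOperator, toWords_face hβ,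
      Fin.val_succ, faceM_rot (n := q + 1) (by omega) (toWords_mem β x), Fin.val_castSucc])

theorem hochschildDifferential_apply (q : ℕ) (x : ⨂[k]^(q + 2) A) :
    hochschildDifferential k A q x =
      barDifferential k A q x + face k A q 0 (cyclicOperator k A (q + 1) x) := by
  rw [hochschildDifferential, LinearMap.add_apply, LinearMap.smul_apply, LinearMap.comp_apply,
    cyclicOperator, LinearMap.smul_apply, map_smul]

end PathAlgebra

/-! ### Linear operators of finite order -/

namespace CyclicHomology

section FiniteOrder

variable {k : Type*} [CommRing k] {E : Type*} [AddCommGroup E] [Module k E]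
  {t : Module.End k E} {n : ℕ}

theorem pow_apply_eq_of_apply_eq {x : E} (hx : t x = x) (i : ℕ) : (t ^ i) x = x := by
  induction i with
  | zero => rfl
  | succ i ih => rw [pow_succ, Module.End.mul_apply, hx, ih]

theorem sum_pow_apply_of_apply_eq {x : E} (hx : t x = x) :
    (∑ i ∈ Finset.range n, t ^ i) x = (n : k) • x := by
  rw [LinearMap.sum_apply, Finset.sum_congr rfl fun i _ => pow_apply_eq_of_apply_eq hx i,
    Finset.sum_const, Finset.card_range, Nat.cast_smul_eq_nsmul]

theorem apply_sum_pow (ht : t ^ n = 1) (x : E) :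
    t ((∑ i ∈ Finset.range n, t ^ i) x) = (∑ i ∈ Finset.range n, t ^ i) x := by
  have := LinearMap.congr_fun (mul_neg_geom_sum t n) x
  rw [ht, sub_self, Module.End.mul_apply] at this
  exact (sub_eq_zero.1 this).symm

theorem sum_pow_apply (ht : t ^ n = 1) (x : E) :
    (∑ i ∈ Finset.range n, t ^ i) (t x) = (∑ i ∈ Finset.range n, t ^ i) x := by
  have := LinearMap.congr_fun (geom_sum_mul_neg t n) x
  rw [ht, sub_self, Module.End.mul_apply, LinearMap.sub_apply, map_sub] at this
  exact (sub_eq_zero.1 this).symm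

theorem apply_pow_eq {N : Type*} [AddCommGroup N] [Module k N] {f : E →ₗ[k] N}
    (hf : ∀ x, f (t x) = f x) (i : ℕ) (x : E) : f ((t ^ i) x) = f x := by
  induction i with
  | zero => rfl
  | succ i ih => rw [pow_succ', Module.End.mul_apply, hf, ih]

theorem apply_sum_pow_eq {N : Type*} [AddCommGroup N] [Module k N] {f : E →ₗ[k] N}
    (hf : ∀ x, f (t x) = f x) (x : E) :
    f ((∑ i ∈ Finset.range n, t ^ i) x) = (n : k) • f x := by
  rw [LinearMap.sum_apply, map_sum, Finset.sum_congr rfl fun i _ => apply_pow_eq hf i x,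
    Finset.sum_const, Finset.card_range, Nat.cast_smul_eq_nsmul]

variable [Algebra ℚ k]

theorem algebraMap_inv_mul (k : Type*) [CommRing k] [Algebra ℚ k] (n : ℕ) :
    algebraMap ℚ k ((n + 1 : ℕ) : ℚ)⁻¹ * ((n + 1 : ℕ) : k) = 1 := by
  have h : ((n + 1 : ℕ) : ℚ) ≠ 0 := by positivity
  rw [← map_natCast (algebraMap ℚ k), ← map_mul, inv_mul_cancel₀ h, map_one]

theorem natCast_smul_injective (n : ℕ) {x y : E}
    (h : ((n + 1 : ℕ) : k) • x = ((n + 1 : ℕ) : k) • y) : x = y := by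
  have := congrArg (algebraMap ℚ k ((n + 1 : ℕ) : ℚ)⁻¹ • ·) h
  simpa only [smul_smul, algebraMap_inv_mul, one_smul] using this

/-- On an invariant vector the norm is multiplication by the invertible number `n + 1`. This is
exactness where `1 - t` leaves. -/
theorem exists_sum_pow_eq {x : E} (hx : t x = x) :
    ∃ u, (∑ i ∈ Finset.range (n + 1), t ^ i) u = x := by
  refine ⟨algebraMap ℚ k ((n + 1 : ℕ) : ℚ)⁻¹ • x, ?_⟩
  rw [map_smul, sum_pow_apply_of_apply_eq hx, smul_smul, algebraMap_inv_mul, one_smul]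

/-- Every `x - t ^ j x` lies in the image of `1 - t`, by a geometric sum. Their average over `j` is
`x` when the norm of `x` vanishes. -/
theorem exists_sub_eq {x : E} (hx : (∑ i ∈ Finset.range (n + 1), t ^ i) x = 0) :
    ∃ u, u - t u = x := by
  have h : ∀ j, ∃ u, u - t u = x - (t ^ j) x := fun j =>
    ⟨(∑ i ∈ Finset.range j, t ^ i) x, LinearMap.congr_fun (mul_neg_geom_sum t j) x⟩
  choose u hu using h
  refine ⟨algebraMap ℚ k ((n + 1 : ℕ) : ℚ)⁻¹ • ∑ j ∈ Finset.range (n + 1), u j, ?_⟩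
  rw [map_smul, ← smul_sub, map_sum, ← Finset.sum_sub_distrib, Finset.sum_congr rfl fun j _ => hu j,
    Finset.sum_sub_distrib, ← LinearMap.sum_apply, hx, sub_zero, Finset.sum_const,
    Finset.card_range, ← Nat.cast_smul_eq_nsmul k, smul_smul, algebraMap_inv_mul, one_smul]

end FiniteOrder

end CyclicHomology

/-! ### The norm intertwines the two vertical differentials -/

namespace PathAlgebra

open AnyPath Words CyclicHomology

variable {k : Type w} [CommRing k] [Algebra ℚ k] {V : Type u} [Quiver.{v} V] {A : Type*}
  [NonUnitalRing A] [Module k A] [IsScalarTower k A A] [SMulCommClass k A A]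

/-- The relation `N b = b' N`, obtained by averaging. As `N b` kills the image of `1 - t`, the chain
`x` may be replaced by the invariant chain `y = N x` at the cost of a factor `q + 2`. On `y` all
signed faces have the same norm, equal to `b' y`; the `q + 2` faces of `b` then give `(q + 2) b' y`.
-/
theorem normOperator_hochschildDifferential {β : Module.Basis (AnyPath V) k A}
    (hβ : IsPathBasis β) (q : ℕ) (x : ⨂[k]^(q + 2) A) :
    normOperator k A q (hochschildDifferential k A q x) =
      barDifferential k A q (normOperator k A (q + 1) x) := by
  have ht := cyclicOperator_pow β q
  have ht' := cyclicOperator_pow β (q + 1)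
  set t := cyclicOperator k A q
  set t' := cyclicOperator k A (q + 1) with ht'_def
  set y := normOperator k A (q + 1) x with hy
  have hty : t' y = y := apply_sum_pow ht' x
  have hface : ∀ i : Fin (q + 1), normOperator k A q ((-1 : k) ^ (i : ℕ) • face k A q i y) =
      normOperator k A q (face k A q 0 y) := by
    intro i
    induction i using Fin.induction with
    | zero => simp
    | succ i ih =>
      rw [← ih]
      conv_lhs => rw [← hty, ht'_def, face_cyclicOperator hβ]
      rw [Fin.val_succ, Fin.val_castSucc, pow_succ, mul_neg_one, neg_smul_neg, ← map_smul]
      exact sum_pow_apply ht _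
  have hbar : normOperator k A q (barDifferential k A q y) =
      ((q + 1 : ℕ) : k) • normOperator k A q (face k A q 0 y) := by
    rw [barDifferential, LinearMap.sum_apply, map_sum]
    simp only [LinearMap.smul_apply, hface]
    rw [Finset.sum_const, Finset.card_univ, Fintype.card_fin, Nat.cast_smul_eq_nsmul]
  have h1 : ((q + 2 : ℕ) : k) • normOperator k A q (hochschildDifferential k A q x) =
      normOperator k A q (hochschildDifferential k A q y) := by
    symm
    refine apply_sum_pow_eq (f := normOperator k A q ∘ₗ hochschildDifferential k A q)
      (fun z => ?_) x
    rw [eq_comm, ← sub_eq_zero, ← map_sub, LinearMap.comp_apply, hochschildDifferential_sub hβ,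
      map_sub, sub_eq_zero]
    exact (sum_pow_apply ht _).symm
  have h2 : t (barDifferential k A q y) = barDifferential k A q y := by
    have := hochschildDifferential_sub hβ q y
    rw [← ht'_def, hty, sub_self, map_zero] at this
    exact (sub_eq_zero.1 this.symm).symm
  have h3 : normOperator k A q (barDifferential k A q y) =
      ((q + 1 : ℕ) : k) • barDifferential k A q y := sum_pow_apply_of_apply_eq h2
  have h4 : normOperator k A q (face k A q 0 y) = barDifferential k A q y :=
    natCast_smul_injective q (hbar.symm.trans h3)
  refine natCast_smul_injective (k := k) (q + 1) (h1.trans ?_)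
  rw [hochschildDifferential_apply, ← ht'_def, hty, map_add, h3, h4]
  push_cast
  module

end PathAlgebra

/-! ### The total complex -/

namespace CyclicHomology

section

variable {k : Type*} [CommRing k] {A : Type*} [NonUnitalRing A] [Module k A]

/-- The component of an element of the total complex in row `q`. -/
def row {n : ℕ} (z : Tot k A n) (q : ℕ) (hq : q < n + 1) : ⨂[k]^(q + 1) A := z ⟨q, hq⟩

/-- The element of the total complex with a single component. -/
def ofRow (n q : ℕ) (hq : q < n + 1) (u : ⨂[k]^(q + 1) A) : Tot k A n :=
  Pi.single (M := fun q : Fin (n + 1) => ⨂[k]^((q : ℕ) + 1) A) ⟨q, hq⟩ u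

theorem row_ext {n : ℕ} {z z' : Tot k A n} (h : ∀ q hq, row z q hq = row z' q hq) : z = z' :=
  funext fun q => h q q.2

theorem row_zero {n : ℕ} (q : ℕ) (hq : q < n + 1) : row (0 : Tot k A n) q hq = 0 := rfl

theorem row_sub {n : ℕ} (z z' : Tot k A n) (q : ℕ) (hq : q < n + 1) :
    row (z - z') q hq = row z q hq - row z' q hq := rfl

theorem row_add {n : ℕ} (z z' : Tot k A n) (q : ℕ) (hq : q < n + 1) :
    row (z + z') q hq = row z q hq + row z' q hq := rfl

theorem row_ofRow {n q : ℕ} (hq : q < n + 1) (u : ⨂[k]^(q + 1) A) :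
    row (ofRow n q hq u) q hq = u :=
  Pi.single_eq_same (M := fun q : Fin (n + 1) => ⨂[k]^((q : ℕ) + 1) A) _ _

theorem row_ofRow_of_ne {n q q' : ℕ} (hq : q < n + 1) (hq' : q' < n + 1) (h : q' ≠ q)
    (u : ⨂[k]^(q + 1) A) : row (ofRow n q hq u) q' hq' = 0 :=
  Pi.single_eq_of_ne (M := fun q : Fin (n + 1) => ⨂[k]^((q : ℕ) + 1) A)
    (fun h' => h (congrArg Fin.val h')) _

variable [IsScalarTower k A A] [SMulCommClass k A A]

theorem row_differential_of_even {n : ℕ} (z : Tot k A (n + 1)) {q : ℕ} (hq : q < n + 1)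
    (h : Even (n - q)) :
    row (differential k A n z) q hq =
      hochschildDifferential k A q (row z (q + 1) (by omega)) +
      (row z q (by omega) - cyclicOperator k A q (row z q (by omega))) := by
  rw [row, differential, LinearMap.pi_apply, if_pos h]
  rfl

theorem row_differential_of_not_even {n : ℕ} (z : Tot k A (n + 1)) {q : ℕ} (hq : q < n + 1)
    (h : ¬ Even (n - q)) :
    row (differential k A n z) q hq =
      -barDifferential k A q (row z (q + 1) (by omega)) +
      normOperator k A q (row z q (by omega)) := by
  rw [row, differential, LinearMap.pi_apply, if_neg h]
  rfl

/-- A map on chains which vanishes on boundaries, is surjective on cycles and such that the cycles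
in its kernel are boundaries computes the homology. -/
theorem exists_equiv_HC {n : ℕ} {N : Type*} [AddCommGroup N] [Module k N]
    (f : Tot k A n →ₗ[k] N) (hd : ∀ y, f (differential k A n y) = 0)
    (hsurj : ∀ x, ∃ z ∈ cycles k A n, f z = x)
    (hker : ∀ z ∈ cycles k A n, f z = 0 → z ∈ boundaries k A n) :
    ∃ e : HC k A n ≃ₗ[k] N, ∀ z : cycles k A n, e (Submodule.Quotient.mk z) = f z := by
  set g := f ∘ₗ (cycles k A n).subtype
  have hg : Function.Surjective g := fun x => by
    obtain ⟨z, hz, rfl⟩ := hsurj x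
    exact ⟨⟨z, hz⟩, rfl⟩
  have hk : (boundaries k A n).submoduleOf (cycles k A n) = LinearMap.ker g := by
    ext z
    rw [LinearMap.mem_ker]
    constructor
    · rintro ⟨y, hy⟩
      exact (congrArg f hy).symm.trans (hd y)
    · exact hker z z.2
  exact ⟨(Submodule.quotEquivOfEq _ _ hk).trans (g.quotKerEquivOfSurjective hg), fun z => rfl⟩

end

end CyclicHomology

/-! ### Reduction of the total complex to the cyclic quotient -/

namespace PathAlgebra

open AnyPath Words CyclicHomology

variable {k : Type w} [CommRing k] {V : Type u} [Quiver.{v} V] {A : Type*} [NonUnitalRing A]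
  [Module k A] {β : Module.Basis (AnyPath V) k A}

/-- The vertex part of the component in column zero. -/
def vertexPartTot (β : Module.Basis (AnyPath V) k A) (n : ℕ) : Tot k A n →ₗ[k] V →₀ k :=
  vertexPart k V ∘ₗ toWords β n ∘ₗ LinearMap.proj (Fin.last n)

theorem vertexPartTot_apply {n : ℕ} (z : Tot k A n) :
    vertexPartTot β n z = vertexPart k V (toWords β n (row z n (by omega))) := rfl

variable [Algebra ℚ k] [IsScalarTower k A A] [SMulCommClass k A A]

/-- Columns and rows are complexes, and the signs in the odd columns turn `b (1 - t) = (1 - t) b'`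
and `N b = b' N` into anticommuting squares. -/
theorem differential_differential (hβ : IsPathBasis β) (n : ℕ) (y : Tot k A (n + 2)) :
    differential k A n (differential k A (n + 1) y) = 0 := by
  refine row_ext fun q hq => ?_
  have hn : n + 1 - q = n - q + 1 := by omega
  have hs : n + 1 - (q + 1) = n - q := by omega
  have ht := cyclicOperator_pow β q
  rw [row_zero]
  by_cases h : Even (n - q)
  · rw [row_differential_of_even _ _ h, row_differential_of_even _ _ (hs ▸ h),
      row_differential_of_not_even _ _ (by rw [hn, Nat.even_add_one]; simpa using h),
      map_add, map_add, hochschildDifferential_hochschildDifferential hβ,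
      hochschildDifferential_sub hβ, map_neg, normOperator, apply_sum_pow ht]
    abel
  · rw [row_differential_of_not_even _ _ h, row_differential_of_not_even _ _ (hs ▸ h),
      row_differential_of_even _ _ (by rw [hn, Nat.even_add_one]; simpa using h),
      map_add, map_add, map_neg, map_sub, barDifferential_barDifferential hβ,
      normOperator_hochschildDifferential hβ,
      show normOperator k A q (cyclicOperator k A q _) = normOperator k A q _ from
        sum_pow_apply ht _]
    abel

/-- A cycle whose component in column zero vanishes is a boundary. -/
theorem mem_boundaries_of_last_eq_zero (hβ : IsPathBasis β) {n : ℕ} {z : Tot k A (n + 1)}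
    (hz : differential k A n z = 0) (h0 : row z (n + 1) (by omega) = 0) :
    z ∈ boundaries k A (n + 1) := by
  -- The components are removed from the highest row downwards; `j` bounds the rows that may still
  -- be nonzero.
  suffices H : ∀ j : ℕ, j ≤ n + 1 → ∀ z : Tot k A (n + 1), differential k A n z = 0 →
      (∀ q hq, j ≤ q → row z q hq = 0) → z ∈ boundaries k A (n + 1) by
    refine H (n + 1) le_rfl z hz fun q hq h => ?_
    obtain rfl : q = n + 1 := by omega
    exact h0
  intro j
  induction j with
  | zero =>
    intro _ z _ h
    obtain rfl : z = 0 := row_ext fun q hq => h q hq (Nat.zero_le _)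
    exact zero_mem _
  | succ j ih =>
    intro hj z hz h
    have hsucc : row z (j + 1) (by omega) = 0 := h _ _ le_rfl
    have hn : n + 1 - j = n - j + 1 := by omega
    have hzj : row (differential k A n z) j hj = 0 := by rw [hz, row_zero]
    -- Row `j + 1` of the cycle is zero, so its component in row `j` is killed by the horizontal
    -- map. Exactness of the row provides a preimage `u` one column further.
    obtain ⟨u, hu⟩ : ∃ u : ⨂[k]^(j + 1) A,
        row (differential k A (n + 1) (ofRow (n + 2) j (by omega) u)) j (by omega) =
          row z j (by omega) := by
      by_cases hev : Even (n - j)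
      · rw [row_differential_of_even _ _ hev, hsucc, map_zero, zero_add] at hzj
        obtain ⟨u, hu⟩ := exists_sum_pow_eq (n := j) (sub_eq_zero.1 hzj).symm
        refine ⟨u, ?_⟩
        rw [row_differential_of_not_even _ _ (by rw [hn, Nat.even_add_one]; simpa using hev),
          row_ofRow_of_ne _ _ (by omega), map_zero, neg_zero, zero_add, row_ofRow]
        exact hu
      · rw [row_differential_of_not_even _ _ hev, hsucc, map_zero, neg_zero, zero_add] at hzj
        obtain ⟨u, hu⟩ := exists_sub_eq (n := j) hzj
        refine ⟨u, ?_⟩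
        rw [row_differential_of_even _ _ (by rw [hn, Nat.even_add_one]; simpa using hev),
          row_ofRow_of_ne _ _ (by omega), map_zero, zero_add, row_ofRow]
        exact hu
    set y : Tot k A (n + 2) := ofRow (n + 2) j (by omega) u with hy
    have hd : differential k A (n + 1) y ∈ boundaries k A (n + 1) := ⟨y, rfl⟩
    rw [← sub_add_cancel z (differential k A (n + 1) y)]
    -- The boundary of a chain concentrated in row `j` lives in rows `j` and `j - 1`, so the
    -- vanishing rows above are not disturbed.
    refine add_mem (ih (by omega) _ ?_ fun q hq hjq => ?_) hd
    · rw [map_sub, hz, differential_differential hβ, sub_zero]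
    · rw [row_sub]
      obtain rfl | hjq := hjq.eq_or_lt
      · rw [hu, sub_self]
      · rw [h q hq hjq, zero_sub, neg_eq_zero]
        by_cases hev : Even (n + 1 - q)
        · rw [row_differential_of_even _ _ hev, row_ofRow_of_ne _ _ (by omega),
            row_ofRow_of_ne _ _ (by omega), map_zero, map_zero, sub_zero, add_zero]
        · rw [row_differential_of_not_even _ _ hev, row_ofRow_of_ne _ _ (by omega),
            row_ofRow_of_ne _ _ (by omega), map_zero, map_zero, neg_zero, add_zero]

/-- A cycle is a boundary if its component in column zero is one in the cyclic quotient. -/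
theorem mem_boundaries_of_last (hβ : IsPathBasis β) {n : ℕ} {z : Tot k A (n + 1)}
    (hz : differential k A n z = 0) (y : ⨂[k]^(n + 3) A) (x : ⨂[k]^(n + 2) A)
    (h : row z (n + 1) (by omega) = hochschildDifferential k A (n + 1) y +
      (x - cyclicOperator k A (n + 1) x)) :
    z ∈ boundaries k A (n + 1) := by
  set c : Tot k A (n + 2) := ofRow (n + 2) (n + 2) (by omega) y +
    ofRow (n + 2) (n + 1) (by omega) x with hc
  have hd : differential k A (n + 1) c ∈ boundaries k A (n + 1) := ⟨c, rfl⟩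
  rw [← sub_add_cancel z (differential k A (n + 1) c)]
  refine add_mem (mem_boundaries_of_last_eq_zero hβ ?_ ?_) hd
  · rw [map_sub, hz, differential_differential hβ, sub_zero]
  · rw [row_sub, row_differential_of_even _ _ (by simp), h, hc, row_add, row_add, row_ofRow,
      row_ofRow, row_ofRow_of_ne _ _ (by omega), row_ofRow_of_ne _ _ (by omega), add_zero,
      zero_add, sub_self]

/-- A cycle of positive degree is a boundary if the part of weight zero of its component in column
zero is trivial in the cyclic quotient. -/
theorem mem_boundaries_of_weightZero (hβ : IsPathBasis β) {n : ℕ} {z : Tot k A (n + 1)}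
    (hz : differential k A n z = 0)
    (h : weightZero (toWords β (n + 1) (row z (n + 1) (by omega))) ∈ commutators k V (n + 2)) :
    z ∈ boundaries k A (n + 1) := by
  set x := row z (n + 1) (by omega) with hx
  have hb : hoch k V (toWords β (n + 1) x) ∈ commutators k V (n + 1) := by
    -- The cycle equation in column zero says that `b x` lies in the image of `1 - t`.
    have hzl : row (differential k A n z) n (by omega) = 0 := by rw [hz, row_zero]
    rw [row_differential_of_even _ _ (by simp)] at hzl
    rw [← toWords_hochschildDifferential hβ, hx, eq_neg_of_add_eq_zero_left hzl]
    exact toWords_mem_commutators β (neg_mem ⟨row z n (by omega), rfl⟩)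
  obtain ⟨y', hy', hxy⟩ := exists_hoch_of_hoch_mem (toWords_mem β x) hb h
  obtain ⟨y, rfl⟩ := exists_toWords_eq β hy'
  rw [← toWords_hochschildDifferential hβ, ← map_sub] at hxy
  obtain ⟨v, hv⟩ := sub_mem_range_of_commutators β hxy
  refine mem_boundaries_of_last hβ hz y v ?_
  rw [← sub_eq_iff_eq_add']
  exact hv.symm

/-- Cyclic homology vanishes in odd degrees. -/
theorem subsingleton_HC_of_odd (hβ : IsPathBasis β) {n : ℕ} (hn : Odd n) :
    Subsingleton (HC k A n) := by
  obtain ⟨c, rfl⟩ := hn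
  rw [Submodule.Quotient.subsingleton_iff, eq_top_iff]
  intro z _
  exact mem_boundaries_of_weightZero hβ z.2
    (weightZero_mem_of_odd (odd_two_mul_add_one c) (toWords_mem β _))

/-- There is a cycle whose component in column zero is a power of the idempotent of a vertex. -/
theorem exists_cycle (hβ : IsPathBasis β) {n : ℕ} (hn : Odd n) (a : V) :
    ∃ z : Tot k A (n + 1), differential k A n z = 0 ∧
      vertexPartTot β (n + 1) z = Finsupp.single a 1 := by
  set e : ∀ q : ℕ, ⨂[k]^(q + 1) A := fun q => tensorBasis β q fun _ => idPath a with he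
  have hword : ∀ q, toWords β q (e q) = word k (List.replicate (q + 1) (idPath a)) := by
    intro q
    rw [he, toWords_tensorBasis, List.ofFn_const]
  have ht : ∀ q, cyclicOperator k A q (e q) = (-1 : k) ^ q • e q := fun q =>
    toWords_injective β q (by rw [toWords_cyclicOperator, map_smul, hword, rot_replicate])
  have hb : ∀ q, hochschildDifferential k A q (e (q + 1)) =
      (if Even q then (0 : k) else 1) • e q := fun q =>
    toWords_injective β q (by
      rw [toWords_hochschildDifferential hβ, map_smul, hword, hword, hoch_replicate])
  have hb' : ∀ q, barDifferential k A q (e (q + 1)) =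
      (if Even (q + 1) then (0 : k) else 1) • e q := fun q =>
    toWords_injective β q (by
      rw [toWords_barDifferential hβ, map_smul, hword, hword, bar_replicate])
  -- the coefficients of the cycle are determined by descending recursion
  set d : ℕ → k := fun q => if Even q then algebraMap ℚ k ((q + 1 : ℕ) : ℚ)⁻¹ else
    -algebraMap ℚ k ((1 + 1 : ℕ) : ℚ)⁻¹ with hd
  set c : ℕ → k := fun q => ∏ j ∈ Finset.Ico q (n + 1), d j with hc
  have hcq : ∀ q, q < n + 1 → c q = d q * c (q + 1) := fun q hq =>
    Finset.prod_eq_prod_Ico_succ_bot hq d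
  refine ⟨fun q => c q • e q, row_ext fun q hq => ?_, ?_⟩
  · have hrow : ∀ q hq, row (fun q => c q • e q : Tot k A (n + 1)) q hq = c q • e q :=
      fun _ _ => rfl
    rw [row_zero]
    by_cases h : Even (n - q)
    -- For odd `q`, where `1 - t` is multiplication by `2`, the equation reads `c (q + 1) + 2 c q =
    -- 0`.
    · have hq' : ¬ Even q := by
        rw [Nat.even_sub (by omega)] at h
        rwa [← h, Nat.not_even_iff_odd]
      rw [row_differential_of_even _ _ h, hrow, hrow, map_smul, map_smul, hb, ht, if_neg hq',
        (Nat.not_even_iff_odd.1 hq').neg_one_pow, hcq q hq, hd]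
      dsimp only
      rw [if_neg hq']
      have := algebraMap_inv_mul k 1
      push_cast at this ⊢
      linear_combination (norm := module) -(this • (c (q + 1) • e q))
    -- For even `q`, where the norm is multiplication by `q + 1`, the equation reads `-c (q + 1) +
    -- (q + 1) c q = 0`.
    · have hq' : Even q := by
        rw [Nat.even_sub (by omega), not_iff, ] at h
        exact h.1 (Nat.not_even_iff_odd.2 hn)
      rw [row_differential_of_not_even _ _ h, hrow, hrow, map_smul, map_smul, hb',
        if_neg (by rw [Nat.even_add_one]; simpa using hq'), normOperator,
        sum_pow_apply_of_apply_eq (by rw [ht, hq'.neg_one_pow, one_smul]), hcq q hq, hd]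
      dsimp only
      rw [if_pos hq', one_smul, smul_smul, mul_right_comm, algebraMap_inv_mul, one_mul,
        neg_add_cancel]
  · rw [vertexPartTot_apply]
    change vertexPart k V (toWords β (n + 1) (c (n + 1) • e (n + 1))) = _
    rw [map_smul, hword, map_smul, vertexPart_replicate, hc]
    simp

/-- Cyclic homology in positive even degrees. -/
theorem nonempty_equiv_HC_of_even (hβ : IsPathBasis β) {n : ℕ} (hn : Even n) (h0 : n ≠ 0) :
    Nonempty (HC k A n ≃ₗ[k] (V →₀ k)) := by
  obtain ⟨n, rfl⟩ := Nat.exists_eq_succ_of_ne_zero h0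
  have hodd : Odd n := by simpa [Nat.even_add_one] using hn
  refine ⟨(exists_equiv_HC (vertexPartTot β (n + 1)) (fun y => ?_) (fun x => ?_)
    (fun z hz hz0 => ?_)).choose⟩
  · rw [vertexPartTot_apply, row_differential_of_even _ _ (by simp), map_add, map_sub,
      toWords_hochschildDifferential hβ, toWords_cyclicOperator, map_add, map_sub,
      vertexPart_hoch hn (toWords_mem β _), vertexPart_rot hn (toWords_mem β _), sub_self,
      add_zero]
  · choose z hz hza using exists_cycle hβ hodd
    refine ⟨Finsupp.linearCombination k z x, ?_, ?_⟩
    · rw [Finsupp.linearCombination_apply]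
      exact Submodule.finsuppSum_mem _ _ _ _ fun a _ => Submodule.smul_mem _ _ (hz a)
    · rw [Finsupp.linearCombination_apply, map_finsuppSum]
      simp only [map_smul, hza, Finsupp.smul_single, smul_eq_mul, mul_one]
      exact Finsupp.sum_single x
  · refine mem_boundaries_of_weightZero hβ hz ?_
    rw [weightZero_eq (toWords_mem β _), ← vertexPartTot_apply, hz0, map_zero]
    exact zero_mem _

end PathAlgebra

/-! ### Cyclic homology in degree zero -/

namespace Quiver

variable {V : Type u} [Quiver.{v} V]

/-- A single rotation carries the last arrow to the front, so the arrows of one factor pass to the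
other end one at a time. -/
theorem CycleOrbit.mk_comp_comm {a b : V} (p : Path b a) (q : Path a b) :
    (Quot.mk _ ⟨a, q.comp p⟩ : CycleOrbit V) = Quot.mk _ ⟨b, p.comp q⟩ := by
  have key : ∀ {c : V} (q : Path a c) (p : Path c a),
      (Quot.mk _ ⟨c, p.comp q⟩ : CycleOrbit V) = Quot.mk _ ⟨a, q.comp p⟩ := by
    intro c q
    induction q with
    | nil => intro p; rw [Path.comp_nil, Path.nil_comp]
    | cons q e ih =>
      intro p
      have h := Quot.sound (r := fun γ γ' : ClosedPath V => γ' = γ.rotate)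
        (a := ⟨_, (p.comp q).cons e⟩) rfl
      rw [Path.comp_cons]
      refine h.trans ?_
      have := ih (e.toPath.comp p)
      rw [Path.comp_assoc, ← Path.comp_assoc q] at this
      exact this
  exact (key q p).symm

end Quiver

namespace PathAlgebra

open AnyPath Words CyclicHomology

section DegreeZero

variable {k : Type w} [CommRing k] {V : Type u} [Quiver.{v} V]

open Classical in
variable (k) in
/-- The orbit of a closed path, and zero for the other paths. -/
def orbitClass (p : AnyPath V) : Quiver.CycleOrbit V →₀ k :=
  if h : p.2.1 = p.1 then Finsupp.single (Quot.mk _ ⟨p.1, p.2.2.cast rfl h⟩) 1 else 0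

theorem orbitClass_closed {a : V} (p : Quiver.Path a a) :
    orbitClass k ⟨a, a, p⟩ = Finsupp.single (Quot.mk _ ⟨a, p⟩) 1 :=
  dif_pos rfl

theorem orbitClass_of_ne {p : AnyPath V} (h : p.2.1 ≠ p.1) : orbitClass k p = 0 :=
  dif_neg h

-- If only one of the two composites exists, it is not closed and its class is zero. If both exist,
-- they are rotations of each other.
open Classical in
theorem orbitClass_comp_comm (p q : AnyPath V) :
    (if p.Composable q then orbitClass k (comp p q) else 0) =
      if q.Composable p then orbitClass k (comp q p) else 0 := by
  have key : ∀ p q : AnyPath V, ¬ q.Composable p →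
      (if p.Composable q then orbitClass k (comp p q) else 0) = 0 := by
    intro p q h
    split_ifs with h'
    · refine orbitClass_of_ne ?_
      rwa [h'.comp_snd, comp_fst]
    · rfl
  by_cases h : q.Composable p
  · by_cases h' : p.Composable q
    · obtain ⟨a, b, p⟩ := p
      obtain ⟨b', a', q⟩ := q
      obtain rfl : a' = a := h
      obtain rfl : b = b' := h'
      rw [if_pos rfl, if_pos rfl, comp_mk, comp_mk, orbitClass_closed, orbitClass_closed,
        Quiver.CycleOrbit.mk_comp_comm]
    · rw [if_neg h', key q p h']
  · rw [if_neg h, key p q h]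

variable (k V) in
/-- The orbits of the closed paths in a combination of words of length one. -/
def orbitPart : Words k V →ₗ[k] Quiver.CycleOrbit V →₀ k :=
  lift fun
    | [p] => orbitClass k p
    | _ => 0

theorem orbitPart_singleton (p : AnyPath V) :
    orbitPart k V (word k [p]) = orbitClass k p := by
  rw [orbitPart, lift_word]

theorem hoch_pair (p q : AnyPath V) :
    hoch k V (word k [p, q]) = mulHead p (word k [q]) - mulHead q (word k [p]) := by
  have : [p, q] = [p] ++ [q] := rfl
  rw [hoch_apply, ← consM_word, bar_consM, bar_singleton, map_zero, sub_zero, consM_word, this,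
    mergeHead_rot_append, List.length_singleton, pow_one, neg_one_smul, sub_eq_add_neg]

open Classical in
theorem mulHead_singleton (p q : AnyPath V) :
    mulHead p (word k [q]) = if p.Composable q then word k [comp p q] else 0 := by
  rw [← consM_word, mulHead_consM, consM_word]

theorem orbitPart_hoch {m : Words k V} (hm : m ∈ homogeneous k V 2) :
    orbitPart k V (hoch k V m) = 0 := by
  refine eq_of_mem (f := orbitPart k V ∘ₗ hoch k V) (g := 0) (fun l (hl : l.length = 2) => ?_) hm
  obtain ⟨p, q, rfl⟩ := List.length_eq_two.1 hl
  rw [LinearMap.comp_apply, LinearMap.zero_apply, hoch_pair, map_sub, sub_eq_zero,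
    mulHead_singleton, mulHead_singleton, apply_ite (orbitPart k V), apply_ite (orbitPart k V),
    orbitPart_singleton, orbitPart_singleton, map_zero, orbitClass_comp_comm]

theorem orbitPart_rot {m : Words k V} (hm : m ∈ homogeneous k V 1) :
    orbitPart k V (rot k V m) = orbitPart k V m := by
  refine eq_of_mem (f := orbitPart k V ∘ₗ rot k V) (fun l (hl : l.length = 1) => ?_) hm
  obtain ⟨p, rfl⟩ := List.length_eq_one_iff.1 hl
  rw [LinearMap.comp_apply, ← List.nil_append [p], rot_append, List.length_nil, pow_zero, one_smul,
    List.nil_append]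

variable {A : Type*} [NonUnitalRing A] [Module k A] {β : Module.Basis (AnyPath V) k A}

/-- A path as an element of the first tensor power. -/
def pathTensor (β : Module.Basis (AnyPath V) k A) (p : AnyPath V) : ⨂[k]^(0 + 1) A :=
  tensorBasis β 0 fun _ => p

theorem toWords_pathTensor (p : AnyPath V) : toWords β 0 (pathTensor β p) = word k [p] := by
  rw [pathTensor, toWords_tensorBasis, List.ofFn_const]; rfl

/-- The orbits of the closed paths in a chain of degree zero. -/
def orbitPartTot (β : Module.Basis (AnyPath V) k A) : Tot k A 0 →ₗ[k] Quiver.CycleOrbit V →₀ k :=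
  orbitPart k V ∘ₗ toWords β 0 ∘ₗ LinearMap.proj 0

theorem orbitPartTot_apply (z : Tot k A 0) :
    orbitPartTot β z = orbitPart k V (toWords β 0 (row z 0 one_pos)) := rfl

variable [IsScalarTower k A A] [SMulCommClass k A A]

theorem pathTensor_sub_mem (hβ : IsPathBasis β) {a b : V} (p : Quiver.Path a b)
    (q : Quiver.Path b a) :
    pathTensor β ⟨a, a, p.comp q⟩ - pathTensor β ⟨b, b, q.comp p⟩ ∈
      LinearMap.range (hochschildDifferential k A 0) := by
  refine ⟨tensorBasis β 1 ![⟨a, b, p⟩, ⟨b, a, q⟩], toWords_injective β 0 ?_⟩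
  rw [toWords_hochschildDifferential hβ, toWords_tensorBasis, map_sub, toWords_pathTensor,
    toWords_pathTensor]
  refine (hoch_pair (⟨a, b, p⟩ : AnyPath V) ⟨b, a, q⟩).trans ?_
  rw [mulHead_singleton, mulHead_singleton, if_pos rfl, if_pos rfl, comp_mk, comp_mk]

/-- An open path is the commutator of itself with the idempotent `e` at its target: `p e = p` and `e
p = 0`. -/
theorem pathTensor_mem (hβ : IsPathBasis β) {p : AnyPath V} (hp : p.2.1 ≠ p.1) :
    pathTensor β p ∈ LinearMap.range (hochschildDifferential k A 0) := by
  refine ⟨tensorBasis β 1 ![p, idPath p.2.1], toWords_injective β 0 ?_⟩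
  rw [toWords_hochschildDifferential hβ, toWords_tensorBasis, toWords_pathTensor]
  refine (hoch_pair p (idPath p.2.1)).trans ?_
  rw [mulHead_singleton, mulHead_singleton, if_pos (show p.Composable (idPath p.2.1) from rfl),
    if_neg (show ¬ (idPath p.2.1).Composable p from hp), sub_zero]
  exact congrArg (fun r => word k [r]) (comp_mk p.2.2 .nil)

/-- A chain of degree zero is determined by its orbits up to commutators. -/
theorem mem_range_of_orbitPart_eq_zero (hβ : IsPathBasis β) {x : ⨂[k]^(0 + 1) A}
    (hx : orbitPart k V (toWords β 0 x) = 0) :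
    x ∈ LinearMap.range (hochschildDifferential k A 0) := by
  set R := LinearMap.range (hochschildDifferential k A 0)
  -- The inverse of the orbit map. It is well defined because rotating the last arrow changes a
  -- closed path by a commutator.
  let s : Quiver.CycleOrbit V → (⨂[k]^(0 + 1) A) ⧸ R :=
    Quot.lift (fun γ => R.mkQ (pathTensor β ⟨γ.1, γ.1, γ.2⟩)) (by
      rintro ⟨a, γ⟩ _ rfl
      cases γ with
      | nil => rfl
      | cons p e => exact (Submodule.Quotient.eq R).2 (pathTensor_sub_mem hβ p e.toPath))
  have h : Finsupp.linearCombination k s ∘ₗ orbitPart k V ∘ₗ toWords β 0 = R.mkQ := by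
    refine (tensorBasis β 0).ext fun f => ?_
    obtain ⟨p, rfl⟩ : ∃ p, f = fun _ => p := ⟨f 0, funext fun i => by
      rw [Fin.fin_one_eq_zero i]⟩
    change Finsupp.linearCombination k s (orbitPart k V (toWords β 0 (pathTensor β p))) =
      R.mkQ (pathTensor β p)
    rw [toWords_pathTensor, orbitPart_singleton]
    by_cases hp : p.2.1 = p.1
    · obtain ⟨a, b, p⟩ := p
      obtain rfl : b = a := hp
      rw [orbitClass_closed]
      exact (Finsupp.linearCombination_single k 1 _).trans (one_smul k _)
    · rw [orbitClass_of_ne hp, map_zero]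
      exact ((Submodule.Quotient.mk_eq_zero R).2 (pathTensor_mem hβ hp)).symm
  rw [← Submodule.Quotient.mk_eq_zero R, ← Submodule.mkQ_apply, ← h, LinearMap.comp_apply,
    LinearMap.comp_apply, hx, map_zero]

/-- Cyclic homology in degree zero. -/
theorem exists_equiv_HC_zero (hβ : IsPathBasis β) :
    ∃ e : HC k A 0 ≃ₗ[k] (Quiver.CycleOrbit V →₀ k), ∀ γ : Quiver.ClosedPath V,
      e (classZero k (β ⟨γ.1, γ.1, γ.2⟩)) = Finsupp.single (Quot.mk _ γ) 1 := by
  have hclass : ∀ γ : Quiver.ClosedPath V,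
      orbitPartTot β (ofRow 0 0 one_pos (pathTensor β ⟨γ.1, γ.1, γ.2⟩)) =
        Finsupp.single (Quot.mk _ γ) 1 := fun γ => by
    rw [orbitPartTot_apply, row_ofRow, toWords_pathTensor, orbitPart_singleton, orbitClass_closed]
  suffices h : ∃ e : HC k A 0 ≃ₗ[k] (Quiver.CycleOrbit V →₀ k),
      ∀ z : cycles k A 0, e (Submodule.Quotient.mk z) = orbitPartTot β z by
    obtain ⟨e, he⟩ := h
    refine ⟨e, fun γ => (he _).trans ?_⟩
    rw [← hclass, orbitPartTot_apply, orbitPartTot_apply, row_ofRow, pathTensor, tensorBasis_apply]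
    rfl
  refine exists_equiv_HC (orbitPartTot β) (fun y => ?_) (fun x => ?_) (fun z _ hz => ?_)
  · rw [orbitPartTot_apply, row_differential_of_even _ _ (by simp), map_add, map_sub,
      toWords_hochschildDifferential hβ, toWords_cyclicOperator, map_add, map_sub,
      orbitPart_hoch (toWords_mem β _), orbitPart_rot (toWords_mem β _), sub_self, add_zero]
  · have : ∀ o : Quiver.CycleOrbit V, ∃ z : Tot k A 0, orbitPartTot β z = Finsupp.single o 1 :=
      Quot.ind fun γ => ⟨_, hclass γ⟩
    choose z hz using this
    refine ⟨Finsupp.linearCombination k z x, Submodule.mem_top, ?_⟩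
    rw [Finsupp.linearCombination_apply, map_finsuppSum]
    simp only [map_smul, hz, Finsupp.smul_single, smul_eq_mul, mul_one]
    exact Finsupp.sum_single x
  · obtain ⟨y, hy⟩ := mem_range_of_orbitPart_eq_zero hβ hz
    refine ⟨ofRow 1 1 (by omega) y, row_ext fun q hq => ?_⟩
    obtain rfl : q = 0 := by omega
    rw [row_differential_of_even _ _ (by simp), row_ofRow, row_ofRow_of_ne _ _ (by omega),
      map_zero, sub_zero, add_zero]
    exact hy

end DegreeZero

/-! ### The path algebra and its quotient by the arrows -/

variable (k : Type w) [CommRing k] (V : Type u) [Quiver.{v} V]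

theorem isPathBasis_pathBasis : IsPathBasis (pathBasis k V) where
  mul_of_composable p q h := by
    obtain ⟨a, b, p⟩ := p
    obtain ⟨b', c, q⟩ := q
    obtain rfl : b = b' := h
    rw [comp_mk]
    exact ofPath_mul_comp k p q
  mul_of_not_composable p q h := ofPath_mul_of_ne k p.2.2 q.2.2 (Ne.symm h)

/-- The projection of the path algebra onto the span of the paths of length zero. -/
def augmentation : PathAlgebra k V →ₗ[k] V →₀ k :=
  (pathBasis k V).constr k fun p => if p.2.2.length = 0 then Finsupp.single p.1 1 else 0

variable {V}

theorem augmentation_ofPath {a b : V} (p : Quiver.Path a b) :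
    augmentation k V (ofPath k p) = if p.length = 0 then Finsupp.single a 1 else 0 :=
  Module.Basis.constr_basis _ _ _ _

/-- Multiplicativity for the pointwise product on `V →₀ k` is what allows the vanishing on arrows to
spread to the whole ideal they generate. -/
theorem augmentation_mul (x y : PathAlgebra k V) :
    augmentation k V (x * y) = augmentation k V x * augmentation k V y := by
  induction x using PathAlgebra.induction with
  | zero => rw [zero_mul, map_zero, zero_mul]
  | add x x' hx hx' => rw [add_mul, map_add, hx, hx', map_add, add_mul]
  | smul_path r p =>
    induction y using PathAlgebra.induction with
    | zero => rw [mul_zero, map_zero, mul_zero]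
    | add y y' hy hy' => rw [mul_add, map_add, hy, hy', map_add, mul_add]
    | smul_path s q =>
      obtain ⟨a, b, p⟩ := p
      obtain ⟨b', c, q⟩ := q
      have key : augmentation k V (ofPath k p * ofPath k q) =
          augmentation k V (ofPath k p) * augmentation k V (ofPath k q) := by
        by_cases h : b' = b
        · subst h
          simp only [ofPath_mul_comp, augmentation_ofPath, Quiver.Path.length_comp,
            Nat.add_eq_zero_iff]
          by_cases hp : p.length = 0
          · obtain rfl := p.eq_of_length_zero hp
            by_cases hq : q.length = 0 <;> simp [hp, hq, ← Finsupp.single_mul]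
          · simp [hp]
        · simp only [ofPath_mul_of_ne k p q h, map_zero, augmentation_ofPath]
          by_cases hp : p.length = 0
          · obtain rfl := p.eq_of_length_zero hp
            rw [if_pos hp]
            split_ifs
            · ext c
              simp only [Finsupp.coe_zero, Pi.zero_apply, Finsupp.mul_apply]
              by_cases hc : a = c
              · subst hc; rw [Finsupp.single_eq_of_ne (Ne.symm h), mul_zero]
              · rw [Finsupp.single_eq_of_ne (Ne.symm hc), zero_mul]
            · rw [mul_zero]
          · rw [if_neg hp, zero_mul]
      dsimp only
      rw [smul_mul_assoc, mul_smul_comm, map_smul, map_smul, map_smul, map_smul, key]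
      ext c
      simp only [Finsupp.smul_apply, Finsupp.mul_apply, smul_eq_mul]
      ring

theorem augmentation_eq_zero {x : PathAlgebra k V} (hx : x ∈ arrowIdeal k V) :
    augmentation k V x = 0 := by
  induction hx using TwoSidedIdeal.span_induction with
  | mem x hx =>
    obtain ⟨a, b, e, rfl⟩ := hx
    rw [augmentation_ofPath, if_neg (by simp)]
  | zero => rw [map_zero]
  | add x y _ _ hx hy => rw [map_add, hx, hy, add_zero]
  | neg x _ hx => rw [map_neg, hx, neg_zero]
  | left_absorb a x _ hx => rw [augmentation_mul, hx, mul_zero]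
  | right_absorb b x _ hx => rw [augmentation_mul, hx, zero_mul]

/-! ### The quotient by the arrows, as a path algebra without arrows -/

namespace ModArrows

variable (V) in
/-- The quotient map as a linear map. -/
def mkLinear : PathAlgebra k V →ₗ[k] ModArrows k V where
  toFun := mk k V
  map_add' := mk_add k
  map_smul' r x := (smul_mk k r x).symm

theorem mkLinear_apply (x : PathAlgebra k V) : mkLinear k V x = mk k V x := rfl

theorem mkLinear_eq_zero_iff (x : PathAlgebra k V) :
    mkLinear k V x = 0 ↔ x ∈ arrowIdeal k V := by
  rw [← map_zero (mkLinear k V), mkLinear_apply, mkLinear_apply, mk_eq_mk_iff, sub_zero]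

/-- The idempotent of a vertex. -/
def idem (a : V) : ModArrows k V := mkLinear k V (ofPath k (.nil : Quiver.Path a a))

/-- The augmentation kills the arrow ideal and sends the vertex idempotents to the standard basis,
so no nontrivial relation between them can hold in the quotient. -/
theorem linearIndependent_idem : LinearIndependent k (idem k : V → ModArrows k V) := by
  rw [linearIndependent_iff]
  intro l hl
  have h1 : Finsupp.linearCombination k (idem k) l = mkLinear k V
      (Finsupp.linearCombination k (fun a : V => ofPath k (.nil : Quiver.Path a a)) l) := by
    rw [Finsupp.linearCombination_apply, Finsupp.linearCombination_apply, map_finsuppSum]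
    simp only [map_smul, idem]
  rw [h1, mkLinear_eq_zero_iff] at hl
  have h2 := augmentation_eq_zero k hl
  rw [Finsupp.linearCombination_apply, map_finsuppSum] at h2
  simp only [map_smul, augmentation_ofPath, Quiver.Path.length_nil, if_true, Finsupp.smul_single,
    smul_eq_mul, mul_one] at h2
  exact (Finsupp.sum_single l).symm.trans h2

theorem span_idem : ⊤ ≤ Submodule.span k (Set.range (idem k : V → ModArrows k V)) := by
  rintro x -
  obtain ⟨x, rfl⟩ := mk_surjective k x
  rw [← mkLinear_apply]
  induction x using PathAlgebra.induction with
  | zero => rw [map_zero]; exact zero_mem _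
  | add x y hx hy => rw [map_add]; exact add_mem hx hy
  | smul_path r p =>
    rw [map_smul]
    refine Submodule.smul_mem _ _ ?_
    obtain ⟨a, b, p⟩ := p
    cases p with
    | nil => exact Submodule.subset_span ⟨a, rfl⟩
    | cons p e =>
      have : ofPath k (p.cons e) ∈ arrowIdeal k V := by
        rw [← Quiver.Path.comp_toPath_eq_cons, ← ofPath_mul_comp]
        exact TwoSidedIdeal.mul_mem_left _ _ _ (TwoSidedIdeal.subset_span ⟨_, _, e, rfl⟩)
      dsimp only
      rw [(mkLinear_eq_zero_iff k _).2 this]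
      exact zero_mem _

variable (V) in
/-- The paths of a quiver without arrows. -/
def vertexEquiv : V ≃ AnyPath (Quiver.Empty V) where
  toFun a := idPath (V := Quiver.Empty V) a
  invFun p := p.1
  left_inv _ := rfl
  right_inv := by
    rintro ⟨a, b, p⟩
    cases p with
    | nil => rfl
    | cons p e => exact e.elim

variable (V) in
/-- The basis of `kΓ / 𝔪` given by the paths of the quiver without arrows. -/
def basis : Module.Basis (AnyPath (Quiver.Empty V)) k (ModArrows k V) :=
  (Module.Basis.mk (linearIndependent_idem k) (span_idem k)).reindex (vertexEquiv V)

theorem basis_vertexEquiv (a : V) :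
    basis k V (vertexEquiv V a) = mk k V (ofPath k (.nil : Quiver.Path a a)) := by
  rw [basis, Module.Basis.reindex_apply, Equiv.symm_apply_apply, Module.Basis.mk_apply]
  rfl

theorem isPathBasis_basis : IsPathBasis (basis k V) where
  mul_of_composable p q h := by
    obtain ⟨a, rfl⟩ := (vertexEquiv V).surjective p
    obtain ⟨b, rfl⟩ := (vertexEquiv V).surjective q
    obtain rfl : a = b := h
    have hc : comp (vertexEquiv V a) (vertexEquiv V a) = vertexEquiv V a := comp_mk .nil .nil
    rw [hc, basis_vertexEquiv, ← mk_mul, ofPath_mul_comp, Quiver.Path.comp_nil]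
  mul_of_not_composable p q h := by
    obtain ⟨a, rfl⟩ := (vertexEquiv V).surjective p
    obtain ⟨b, rfl⟩ := (vertexEquiv V).surjective q
    have h' : b ≠ a := fun h' => h h'.symm
    rw [basis_vertexEquiv, basis_vertexEquiv, ← mk_mul, ofPath_mul_of_ne k _ _ h']
    exact map_zero (mkLinear k V)

variable (V) in
/-- The closed paths of a quiver without arrows are its vertices. -/
def orbitEquiv : Quiver.CycleOrbit (Quiver.Empty V) ≃ V where
  toFun := Quot.lift (fun γ => γ.1) (by
    rintro ⟨a, γ⟩ _ rfl
    cases γ with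
    | nil => rfl
    | cons p e => exact e.elim)
  invFun a := Quot.mk _ ⟨(a : Quiver.Empty V), .nil⟩
  left_inv := by
    rintro ⟨a, γ⟩
    cases γ with
    | nil => rfl
    | cons p e => exact e.elim
  right_inv _ := rfl

end ModArrows

end PathAlgebra
end

theorem mainTheorem4 {k : Type*} [CommRing k] [Algebra ℚ k] (V : Type*) [Quiver V] :
    (∀ c : ℕ, Nonempty
      (CyclicHomology.HC k (PathAlgebra.ModArrows k V) (2 * c) ≃ₗ[k] (V →₀ k))) ∧
    (∀ c : ℕ, Subsingleton (CyclicHomology.HC k (PathAlgebra.ModArrows k V) (2 * c + 1))) ∧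
    (∃ e : CyclicHomology.HC k (PathAlgebra k V) 0 ≃ₗ[k] (Quiver.CycleOrbit V →₀ k),
      ∀ γ : Quiver.ClosedPath V,
        e (CyclicHomology.classZero k (PathAlgebra.ofPath k γ.2)) =
          Finsupp.single (Quot.mk _ γ) 1) ∧
    (∀ c : ℕ, 1 ≤ c → Nonempty
      (CyclicHomology.HC k (PathAlgebra k V) (2 * c) ≃ₗ[k] (V →₀ k))) ∧
    (∀ c : ℕ, Subsingleton (CyclicHomology.HC k (PathAlgebra k V) (2 * c + 1))) := by
  have hΓ := PathAlgebra.isPathBasis_pathBasis k V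
  have hE := PathAlgebra.ModArrows.isPathBasis_basis k (V := V)
  refine ⟨fun c => ?_, fun c => PathAlgebra.subsingleton_HC_of_odd hE (odd_two_mul_add_one c),
    PathAlgebra.exists_equiv_HC_zero hΓ,
    fun c hc => PathAlgebra.nonempty_equiv_HC_of_even hΓ (even_two_mul c) (by omega),
    fun c => PathAlgebra.subsingleton_HC_of_odd hΓ (odd_two_mul_add_one c)⟩
  -- For the quotient, degree zero also follows from the orbit description: without arrows the
  -- orbits of closed paths are the vertices.
  obtain rfl | hc := eq_or_ne c 0
  · obtain ⟨e, -⟩ := PathAlgebra.exists_equiv_HC_zero hE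
    exact ⟨e.trans (Finsupp.domLCongr (PathAlgebra.ModArrows.orbitEquiv V))⟩
  · exact PathAlgebra.nonempty_equiv_HC_of_even hE (even_two_mul c) (by omega)
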